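/- Let $H:[0,\infty)\to[0,1]$ be Borel measurable with $\|H\|_1=\int_0^\infty H(r)\,dr<\infty$. For $L>0$ consider the soft random geometric graph on $[0,L]$ with periodic boundary conditions: the node set is a Poisson point process $\Phi$ of intensity $1$ on $[0,L]$ and, given $\Phi$, each pair of distinct nodes $x,y$ is joined by an edge independently of all other pairs with probability $H(\rho(x,y))$, where $\rho(x,y)=\min(|x-y|,\,L-|x-y|)$ is the toroidal distance. Let $N_{\mathrm{iso}}$ be the number of isolated nodes (nodes having no edge to any other node), and let $c_V^2(X)=\operatorname{Var}(X)/(\mathbb E X)^2$ denote the squared coefficient of variation. (1) There is a finite constant $C$, depending on $H$ but not on $L$, such that for every $L>0$ the variable $N_{\mathrm{iso}}$ is square integrable, $$\mathbb E[N_{\mathrm{iso}}]=L\exp\Bigl(-2\int_0^{L/2}H(r)\,dr\Bigr),\qquad c_V^2(N_{\mathrm{iso}})\le\frac1{\mathbb E[N_{\mathrm{iso}}]}+\frac{4C}{L}\|H\|_1^2,$$ and, for every $\varepsilon>0$, $$\mathbb P\bigl(|N_{\mathrm{iso}}-\mathbb E[N_{\mathrm{iso}}]|>\varepsilon\,\mathbb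 E[N_{\mathrm{iso}}]\bigr)\le\frac{c_V^2(N_{\mathrm{iso}})}{\varepsilon^2}.$$ (2) Consequently $N_{\mathrm{iso}}$ concentrates around its mean and grows linearly in $L$: as $L\to\infty$ (with $H$ fixed), $\mathbb E[N_{\mathrm{iso}}]/L\to e^{-2\|H\|_1}$, and for every $\varepsilon>0$ $$\mathbb P\bigl(|N_{\mathrm{iso}}-\mathbb E[N_{\mathrm{iso}}]|>\varepsilon\,\mathbb E[N_{\mathrm{iso}}]\bigr)\to0,\qquad \mathbb P\bigl(|N_{\mathrm{iso}}/L-e^{-2\|H\|_1}|>\varepsilon\bigr)\to0 .$$ -/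

import Mathlib

open MeasureTheory ProbabilityTheory Filter Topology

universe u

noncomputable section

/-- The number `Φ(B)` of points of the random finite set `Φ` that lie in `B`. -/
def pointCount {Ω : Type u} (Φ : Ω → Finset ℝ) (B : Set ℝ) (ω : Ω) : ℕ :=
  ((Φ ω : Set ℝ) ∩ B).ncard

/-- `Φ` is a homogeneous Poisson point process of intensity `1` on the interval `[0, L]`:
the number of points in a Borel set `B` is Poisson distributed with mean the length of
`B ∩ [0, L]`, and the numbers of points in disjoint Borel sets are mutually independent. -/
structure IsUnitPoissonProcess {Ω : Type u} [MeasurableSpace Ω] (P : Measure Ω) (L : ℝ)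
    (Φ : Ω → Finset ℝ) : Prop where
  subset_Icc : ∀ ω, (Φ ω : Set ℝ) ⊆ Set.Icc 0 L
  measurable_count : ∀ B : Set ℝ, MeasurableSet B → Measurable (pointCount Φ B)
  count_law : ∀ B : Set ℝ, MeasurableSet B →
    P.map (pointCount Φ B) = poissonMeasure (volume (B ∩ Set.Icc 0 L)).toNNReal
  count_indep : ∀ (n : ℕ) (B : Fin n → Set ℝ), (∀ i, MeasurableSet (B i)) →
    Pairwise (fun i j => Disjoint (B i) (B j)) →
    iIndepFun (fun i => pointCount Φ (B i)) P

/-- The σ-algebra on `Ω` generated by the point configuration `Φ`, that is, by the numbers of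
points in Borel sets. -/
@[reducible] def configSigma {Ω : Type u} (Φ : Ω → Finset ℝ) : MeasurableSpace Ω :=
  ⨆ (B : Set ℝ) (_ : MeasurableSet B), MeasurableSpace.comap (pointCount Φ B) ⊤

/-- The toroidal distance between two points of `[0, L]`, the endpoints being identified. -/
def torusDist (L x y : ℝ) : ℝ := min |x - y| (L - |x - y|)

/-- The soft random geometric graph on `[0, L]` with periodic boundary conditions and connection
function `H`. The node set is a Poisson process `Φ` of unit intensity. The pair of nodes `x`, `y`
is joined by an edge when `(G ω).Adj x y` (adjacency outside `Φ ω` plays no role).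

The field `edges` says that, given the configuration `Φ`, the edges between the different
unordered pairs of distinct nodes are independent, and that the edge between `x` and `y` is
present with probability `H (ρ(x, y))`, where `ρ` is the toroidal distance: whenever `k` different
pairs of nodes are selected on an event `A`, the event and the selection being determined by the
configuration, the conditional probability that all of these pairs are edges is the product of the
`k` connection probabilities. -/
structure IsSoftRGG {Ω : Type u} [MeasurableSpace Ω] (P : Measure Ω) (L : ℝ) (H : ℝ → ℝ)
    (Φ : Ω → Finset ℝ) (G : Ω → SimpleGraph ℝ) : Prop where
  nodes : IsUnitPoissonProcess P L Φ
  edges : ∀ (k : ℕ) (x y : Fin k → Ω → ℝ) (A : Set Ω),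
    MeasurableSet[configSigma Φ] A →
    (∀ i, Measurable[configSigma Φ] (x i)) → (∀ i, Measurable[configSigma Φ] (y i)) →
    (∀ ω ∈ A, ∀ i, x i ω ∈ Φ ω ∧ y i ω ∈ Φ ω ∧ x i ω ≠ y i ω) →
    (∀ ω ∈ A, ∀ i j, i ≠ j → s(x i ω, y i ω) ≠ s(x j ω, y j ω)) →
    MeasurableSet {ω | ω ∈ A ∧ ∀ i, (G ω).Adj (x i ω) (y i ω)} ∧
    P {ω | ω ∈ A ∧ ∀ i, (G ω).Adj (x i ω) (y i ω)} =
      ∫⁻ ω in A, ∏ i, ENNReal.ofReal (H (torusDist L (x i ω) (y i ω))) ∂P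

/-- The number of isolated nodes: nodes with no edge to any other node. -/
def numIsolated {Ω : Type u} (Φ : Ω → Finset ℝ) (G : Ω → SimpleGraph ℝ) (ω : Ω) : ℝ :=
  (({x : ℝ | x ∈ Φ ω ∧ ∀ y ∈ Φ ω, y ≠ x → ¬ (G ω).Adj x y} : Set ℝ).ncard : ℝ)

/-- The squared coefficient of variation: the variance divided by the squared mean. -/
def sqCoeffVar {Ω : Type u} [MeasurableSpace Ω] (P : Measure Ω) (X : Ω → ℝ) : ℝ :=
  variance X P / (∫ ω, X ω ∂P) ^ 2

/-- The norm `‖H‖₁ = ∫₀^∞ H` of a nonnegative function `H` on the half-line. -/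
def l1Norm (H : ℝ → ℝ) : ℝ := ∫ r in Set.Ioi (0 : ℝ), H r

end

/-!
Conditionally on the configuration, a node `x` is isolated with probability `∏ (1 - H (ρ(x, y)))`,
the product running over the other nodes `y`. Mecke's formula, together with the generating
functional `E ∏ (1 - u y) = exp (-∫ u)` of the Poisson process, therefore gives the mean
`m = L e^{-D}`, where `D` is the expected degree of a node. Two distinct nodes at `x` and `x'`
are both isolated with probability at most `e^{c - 2 D}`, where `c` is the expected number of their
common neighbours. Since `c ≤ D`, we have `e^c ≤ 1 + e^D c`, and `∫∫ c = L D²` by Fubini and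
rotation invariance; so the second factorial moment is at most `m² (1 + e^D D² / L)`. As
`D ≤ 2 ‖H‖₁`, the constant `C = e^{2 ‖H‖₁}` works, and Chebyshev's inequality does the rest.

Mecke's formula is an equality of finite measures, to be checked on the rectangles formed by a Borel
set and a void event, since void events generate the σ-algebra on configurations. The generating
functional follows from it: the formula restricted to configurations with `n + 1` points expresses
`E [∏ v; n + 1 points]` through `E [∏ v; n points]`, which produces the exponential series.
-/

noncomputable section

open scoped ENNReal

section Configurations

open Classical in
/-- The number of points of the configuration `s` in `B`, the deterministic counterpart of
`pointCount`. -/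
def configCount (B : Set ℝ) (s : Finset ℝ) : ℕ := (s.filter (· ∈ B)).card

/-- The σ-algebra on finite configurations generated by the numbers of points in Borel sets, so
that a random configuration is measurable exactly when all its counts are. -/
instance configMeasurableSpace : MeasurableSpace (Finset ℝ) :=
  ⨆ (B : Set ℝ) (_ : MeasurableSet B), MeasurableSpace.comap (configCount B) ⊤

lemma pointCount_eq_configCount {Ω : Type*} (Φ : Ω → Finset ℝ) (B : Set ℝ) :
    pointCount Φ B = fun ω => configCount B (Φ ω) := by
  funext ω
  rw [pointCount, configCount, ← Set.ncard_coe_finset, Finset.coe_filter]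
  rfl

lemma configSigma_eq_comap {Ω : Type*} (Φ : Ω → Finset ℝ) :
    configSigma Φ = configMeasurableSpace.comap Φ := by
  simp only [configSigma, configMeasurableSpace, MeasurableSpace.comap_iSup,
    MeasurableSpace.comap_comp, pointCount_eq_configCount]
  rfl

lemma measurable_config_configSigma {Ω : Type*} (Φ : Ω → Finset ℝ) :
    Measurable[configSigma Φ] Φ := by
  rw [configSigma_eq_comap]
  exact comap_measurable Φ

lemma configCount_eq_zero_iff {B : Set ℝ} {s : Finset ℝ} :
    configCount B s = 0 ↔ ∀ x ∈ s, x ∉ B := by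
  classical
  rw [configCount, Finset.card_eq_zero, Finset.filter_eq_empty_iff]

open Classical in
lemma card_le_configCount {B : Set ℝ} {s t : Finset ℝ} (h : ∀ x ∈ t, x ∈ s ∧ x ∈ B) :
    t.card ≤ configCount B s :=
  Finset.card_le_card fun x hx => Finset.mem_filter.2 (h x hx)

open Classical in
lemma configCount_le_card {B : Set ℝ} {s t : Finset ℝ} (h : ∀ x ∈ s, x ∈ B → x ∈ t) :
    configCount B s ≤ t.card :=
  Finset.card_le_card fun x hx => h x (Finset.mem_filter.1 hx).1 (Finset.mem_filter.1 hx).2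

lemma configCount_univ (s : Finset ℝ) : configCount Set.univ s = s.card := by
  simp [configCount]

open Classical in
lemma configCount_inter_add_diff (A B : Set ℝ) (s : Finset ℝ) :
    configCount (A ∩ B) s + configCount (A \ B) s = configCount A s := by
  simp only [configCount, Set.mem_inter_iff, Set.mem_sdiff, ← Finset.filter_filter]
  exact Finset.card_filter_add_card_filter_not _

open Classical in
lemma configCount_erase (B : Set ℝ) (s : Finset ℝ) (x : ℝ) :
    configCount B (s.erase x) = configCount B s - if x ∈ s ∧ x ∈ B then 1 else 0 := by
  rw [configCount, configCount, Finset.filter_erase, Finset.card_erase_eq_ite]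
  simp only [Finset.mem_filter]
  split_ifs <;> rfl

@[fun_prop]
lemma measurable_configCount {B : Set ℝ} (hB : MeasurableSet B) : Measurable (configCount B) :=
  (comap_measurable (m := ⊤) (configCount B)).mono
    (le_iSup₂_of_le (f := fun (B : Set ℝ) (_ : MeasurableSet B) =>
      MeasurableSpace.comap (configCount B) ⊤) B hB le_rfl) le_rfl

@[fun_prop]
lemma measurable_finset_card : Measurable (Finset.card : Finset ℝ → ℕ) := by
  simpa only [configCount_univ, funext configCount_univ] using
    measurable_configCount MeasurableSet.univ

lemma measurable_of_measurable_configCount {α : Type*} [MeasurableSpace α] {S : α → Finset ℝ}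
    (h : ∀ B : Set ℝ, MeasurableSet B → Measurable fun a => configCount B (S a)) :
    Measurable S := by
  rw [measurable_iff_comap_le, configMeasurableSpace]
  simp only [MeasurableSpace.comap_iSup, MeasurableSpace.comap_comp]
  exact iSup₂_le fun B hB => (h B hB).comap_le

/-- The event that a configuration has no point in `A`. -/
def voidEvent (A : Set ℝ) : Set (Finset ℝ) := {s | configCount A s = 0}

/-- The void events of Borel sets, a π-system generating the σ-algebra on configurations. -/
def voidEvents : Set (Set (Finset ℝ)) := {E | ∃ A, MeasurableSet A ∧ voidEvent A = E}

lemma mem_voidEvent {A : Set ℝ} {s : Finset ℝ} : s ∈ voidEvent A ↔ configCount A s = 0 := Iff.rfl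

lemma measurableSet_voidEvent {A : Set ℝ} (hA : MeasurableSet A) :
    MeasurableSet (voidEvent A) :=
  measurable_configCount hA (MeasurableSet.singleton 0)

lemma voidEvent_union (A B : Set ℝ) : voidEvent (A ∪ B) = voidEvent A ∩ voidEvent B := by
  ext s
  simp only [mem_voidEvent, configCount_eq_zero_iff, Set.mem_inter_iff, Set.mem_union, not_or,
    forall_and]

lemma isPiSystem_voidEvents : IsPiSystem voidEvents := by
  rintro _ ⟨A, hA, rfl⟩ _ ⟨B, hB, rfl⟩ -
  exact ⟨A ∪ B, hA.union hB, voidEvent_union A B⟩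

lemma exists_rat_le_configCount_Iio {A : Set ℝ} {s : Finset ℝ} {k : ℕ}
    (h : k + 1 ≤ configCount A s) :
    ∃ q : ℚ, k ≤ configCount (A ∩ Set.Iio (q : ℝ)) s ∧ configCount (A \ Set.Iio (q : ℝ)) s ≠ 0 := by
  classical
  set t := s.filter (· ∈ A)
  have ht_card : k + 1 ≤ t.card := h
  have hne : t.Nonempty := Finset.card_pos.1 (by omega)
  set m := t.max' hne
  have hm : m ∈ t := t.max'_mem hne
  obtain ⟨r, hr, hrm⟩ := Order.exists_between_finsets (lo := t.erase m) (hi := {m}) fun x hx y hy =>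
    Finset.mem_singleton.1 hy ▸ t.lt_max'_of_mem_erase_max' hne hx
  obtain ⟨q, hrq, hqm⟩ := exists_rat_btwn (hrm m (Finset.mem_singleton_self m))
  refine ⟨q, ?_, fun h0 => ?_⟩
  · calc k ≤ (t.erase m).card := by rw [Finset.card_erase_of_mem hm]; omega
      _ ≤ configCount (A ∩ Set.Iio (q : ℝ)) s := card_le_configCount fun x hx =>
        have hxt := Finset.mem_filter.1 (Finset.mem_of_mem_erase hx)
        ⟨hxt.1, hxt.2, (hr x hx).trans hrq⟩
  · obtain ⟨hms, hmA⟩ := Finset.mem_filter.1 hm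
    exact configCount_eq_zero_iff.1 h0 m hms ⟨hmA, not_lt.2 hqm.le⟩

lemma succ_le_configCount_iff {A : Set ℝ} {k : ℕ} {s : Finset ℝ} :
    k + 1 ≤ configCount A s ↔ ∃ q : ℚ,
      k ≤ configCount (A ∩ Set.Iio (q : ℝ)) s ∧ configCount (A \ Set.Iio (q : ℝ)) s ≠ 0 := by
  refine ⟨exists_rat_le_configCount_Iio, fun ⟨q, hlt, hge⟩ => ?_⟩
  have := configCount_inter_add_diff A (Set.Iio (q : ℝ)) s
  omega

lemma measurableSet_generateFrom_voidEvents_le_configCount (k : ℕ) {A : Set ℝ}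
    (hA : MeasurableSet A) :
    MeasurableSet[MeasurableSpace.generateFrom voidEvents] {s | k ≤ configCount A s} := by
  induction k generalizing A with
  | zero => simp
  | succ k ih =>
    -- Cutting below the largest point of `s ∩ A` leaves `k` points under the cut.
    have : {s | k + 1 ≤ configCount A s} = ⋃ q : ℚ,
        {s | k ≤ configCount (A ∩ Set.Iio (q : ℝ)) s} ∩ (voidEvent (A \ Set.Iio (q : ℝ)))ᶜ := by
      ext s
      simpa [voidEvent] using succ_le_configCount_iff
    rw [this]
    refine MeasurableSet.iUnion fun q => (ih (hA.inter measurableSet_Iio)).inter ?_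
    refine MeasurableSet.compl (MeasurableSpace.measurableSet_generateFrom ?_)
    exact ⟨_, hA.diff measurableSet_Iio, rfl⟩

lemma generateFrom_voidEvents :
    MeasurableSpace.generateFrom voidEvents = configMeasurableSpace := by
  apply le_antisymm
  · apply MeasurableSpace.generateFrom_le
    rintro _ ⟨A, hA, rfl⟩
    exact measurableSet_voidEvent hA
  · refine iSup₂_le fun B hB => Measurable.comap_le (m₂ := ⊤) ?_
    let := MeasurableSpace.generateFrom voidEvents
    have : Measurable (configCount B) := measurable_of_Ici fun k =>
      measurableSet_generateFrom_voidEvents_le_configCount k hB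
    exact this

end Configurations

section Enumeration

variable {α : Type*} [MeasurableSpace α]

/-- The `i`-th smallest point of a finite configuration, counting from `0`, with the junk value
`0` if there are at most `i` points. It enumerates the points of a random configuration measurably.
-/
def orderedPoint (s : Finset ℝ) (i : ℕ) : ℝ :=
  if h : i < s.card then s.orderEmbOfFin rfl ⟨i, h⟩ else 0

lemma orderedPoint_eq {s : Finset ℝ} {i : ℕ} (h : i < s.card) :
    orderedPoint s i = s.orderEmbOfFin rfl ⟨i, h⟩ := dif_pos h

lemma orderedPoint_mem {s : Finset ℝ} {i : ℕ} (h : i < s.card) : orderedPoint s i ∈ s :=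
  orderedPoint_eq h ▸ Finset.orderEmbOfFin_mem s rfl _

lemma injOn_orderedPoint (s : Finset ℝ) : Set.InjOn (orderedPoint s) (Finset.range s.card) := by
  intro i hi j hj hij
  rw [Finset.coe_range, Set.mem_Iio] at hi hj
  simpa [orderedPoint_eq hi, orderedPoint_eq hj] using hij

lemma image_orderedPoint (s : Finset ℝ) : (Finset.range s.card).image (orderedPoint s) = s := by
  refine Finset.eq_of_subset_of_card_le (fun x hx => ?_) ?_
  · obtain ⟨i, hi, rfl⟩ := Finset.mem_image.1 hx
    exact orderedPoint_mem (Finset.mem_range.1 hi)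
  · rw [Finset.card_image_of_injOn (injOn_orderedPoint s), Finset.card_range]

lemma mem_iff_exists_orderedPoint {s : Finset ℝ} {x : ℝ} :
    x ∈ s ↔ ∃ i < s.card, orderedPoint s i = x := by
  conv_lhs => rw [← image_orderedPoint s]
  simp only [Finset.mem_image, Finset.mem_range]

@[to_additive]
lemma prod_eq_prod_range_orderedPoint {M : Type*} [CommMonoid M] (s : Finset ℝ) (f : ℝ → M) :
    ∏ x ∈ s, f x = ∏ i ∈ Finset.range s.card, f (orderedPoint s i) := by
  conv_lhs => rw [← image_orderedPoint s]
  exact Finset.prod_image (injOn_orderedPoint s)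

lemma lt_configCount_Iic_of_orderedPoint_le {s : Finset ℝ} {i : ℕ} (h : i < s.card) {t : ℝ}
    (ht : orderedPoint s i ≤ t) : i < configCount (Set.Iic t) s := by
  set e := s.orderEmbOfFin rfl
  have hcard : ((Finset.Iic (⟨i, h⟩ : Fin s.card)).map e.toEmbedding).card ≤
      configCount (Set.Iic t) s := by
    refine card_le_configCount fun x hx => ?_
    obtain ⟨j, hj, rfl⟩ := Finset.mem_map.1 hx
    exact ⟨Finset.orderEmbOfFin_mem s rfl j,
      (e.monotone (Finset.mem_Iic.1 hj)).trans (orderedPoint_eq h ▸ ht)⟩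
  simpa using hcard

lemma configCount_Iic_le_of_lt_orderedPoint {s : Finset ℝ} {i : ℕ} (h : i < s.card) {t : ℝ}
    (ht : t < orderedPoint s i) : configCount (Set.Iic t) s ≤ i := by
  set e := s.orderEmbOfFin rfl
  have hcard : configCount (Set.Iic t) s ≤
      ((Finset.Iio (⟨i, h⟩ : Fin s.card)).map e.toEmbedding).card := by
    refine configCount_le_card fun x hxs hxt => ?_
    obtain ⟨j, rfl⟩ : x ∈ Set.range e := by rwa [Finset.range_orderEmbOfFin]
    refine Finset.mem_map.2 ⟨j, Finset.mem_Iio.2 (e.lt_iff_lt.1 ?_), rfl⟩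
    exact (Set.mem_Iic.1 hxt).trans_lt (orderedPoint_eq h ▸ ht)
  simpa using hcard

lemma orderedPoint_le_iff {s : Finset ℝ} {i : ℕ} (h : i < s.card) {t : ℝ} :
    orderedPoint s i ≤ t ↔ i < configCount (Set.Iic t) s :=
  ⟨lt_configCount_Iic_of_orderedPoint_le h, fun hi =>
    not_lt.1 fun ht => (configCount_Iic_le_of_lt_orderedPoint h ht).not_gt hi⟩

lemma measurableSet_lt_card (i : ℕ) : MeasurableSet {s : Finset ℝ | i < s.card} :=
  measurable_finset_card measurableSet_Ioi

@[fun_prop]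
lemma measurable_orderedPoint (i : ℕ) : Measurable fun s => orderedPoint s i := by
  refine measurable_of_Iic fun t => ?_
  have : (fun s => orderedPoint s i) ⁻¹' Set.Iic t =
      {s : Finset ℝ | i < s.card}.ite {s | i < configCount (Set.Iic t) s} {_s | (0 : ℝ) ≤ t} := by
    ext s
    by_cases h : i < s.card
    · simp [Set.ite, h, orderedPoint_le_iff h]
    · simp [Set.ite, h, orderedPoint]
  rw [this]
  exact (measurableSet_lt_card i).ite (measurable_configCount measurableSet_Iic measurableSet_Ioi)
    (MeasurableSet.const _)

lemma measurableSet_mem_config {S : α → Finset ℝ} {X : α → ℝ} (hS : Measurable S)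
    (hX : Measurable X) : MeasurableSet {a | X a ∈ S a} := by
  simp only [mem_iff_exists_orderedPoint, Set.ofPred_exists, Set.ofPred_and]
  refine MeasurableSet.iUnion fun i => (hS (measurableSet_lt_card i)).inter ?_
  exact measurableSet_eq_fun (by fun_prop) hX

@[fun_prop]
lemma measurable_config_erase {α : Type*} {_ : MeasurableSpace α} {S : α → Finset ℝ}
    {X : α → ℝ} (hS : Measurable S) (hX : Measurable X) :
    Measurable fun a => (S a).erase (X a) := by
  refine measurable_of_measurable_configCount fun B hB => ?_
  simp only [configCount_erase]
  exact ((measurable_configCount hB).comp hS).sub <|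
    Measurable.ite ((measurableSet_mem_config hS hX).inter (hX hB)) measurable_const
      measurable_const

lemma measurable_apply_nat {β : Type*} [MeasurableSpace β] {n : α → ℕ} (hn : Measurable n)
    {g : ℕ → α → β} (hg : ∀ k, Measurable (g k)) : Measurable fun a => g (n a) a :=
  (measurable_from_prod_countable_left fun k => hg k :
    Measurable fun p : α × ℕ => g p.2 p.1).comp (measurable_id.prodMk hn)

@[to_additive]
lemma measurable_prod_config {M : Type*} [CommMonoid M] [MeasurableSpace M] [MeasurableMul₂ M]
    {S : α → Finset ℝ} (hS : Measurable S) {f : α → ℝ → M} (hf : Measurable (Function.uncurry f)) :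
    Measurable fun a => ∏ x ∈ S a, f a x := by
  simp only [prod_eq_prod_range_orderedPoint]
  refine measurable_apply_nat (g := fun n a => ∏ i ∈ Finset.range n, f a (orderedPoint (S a) i))
    (by fun_prop) fun n => Finset.measurable_fun_prod _ fun i _ => ?_
  exact hf.comp (measurable_id.prodMk ((measurable_orderedPoint i).comp hS))

end Enumeration

section EnumeratedSums

variable {α : Type*} [MeasurableSpace α] {μ : Measure α} {S : α → Finset ℝ} {f : α → ℝ → ℝ≥0∞}

lemma sum_eq_tsum_indicator_orderedPoint (s : Finset ℝ) (g : ℝ → ℝ≥0∞) :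
    ∑ x ∈ s, g x =
      ∑' i, {s : Finset ℝ | i < s.card}.indicator (fun s => g (orderedPoint s i)) s := by
  rw [sum_eq_sum_range_orderedPoint, tsum_eq_sum (s := Finset.range s.card)]
  · refine Finset.sum_congr rfl fun i hi => ?_
    rw [Set.indicator_of_mem (by simpa using hi)]
  · intro i hi
    rw [Set.indicator_of_notMem (by simpa using hi)]

lemma aemeasurable_sum_config (hS : Measurable S)
    (hf : ∀ i, AEMeasurable (fun a => f a (orderedPoint (S a) i))
      (μ.restrict {a | i < (S a).card})) :
    AEMeasurable (fun a => ∑ x ∈ S a, f a x) μ := by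
  simp only [sum_eq_tsum_indicator_orderedPoint]
  exact AEMeasurable.tsum fun i =>
    (aemeasurable_indicator_iff (hS (measurableSet_lt_card i))).2 (hf i)

lemma lintegral_sum_config (hS : Measurable S)
    (hf : ∀ i, AEMeasurable (fun a => f a (orderedPoint (S a) i))
      (μ.restrict {a | i < (S a).card})) :
    ∫⁻ a, ∑ x ∈ S a, f a x ∂μ =
      ∑' i, ∫⁻ a in {a | i < (S a).card}, f a (orderedPoint (S a) i) ∂μ := by
  have hcard : ∀ i, MeasurableSet {a | i < (S a).card} := fun i => hS (measurableSet_lt_card i)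
  simp only [sum_eq_tsum_indicator_orderedPoint, ← lintegral_indicator (hcard _)]
  exact lintegral_tsum fun i => (aemeasurable_indicator_iff (hcard i)).2 (hf i)

/-- The configurations that have an `i`-th smallest point, and a `j`-th smallest one among the
remaining points. -/
def pairEvent (i j : ℕ) : Set (Finset ℝ) :=
  {s | i < s.card ∧ j < (s.erase (orderedPoint s i)).card}

/-- The `j`-th smallest among the points other than the `i`-th smallest one. Together with
`orderedPoint s i` it enumerates the ordered pairs of distinct points of `s`. -/
def orderedPartner (s : Finset ℝ) (i j : ℕ) : ℝ := orderedPoint (s.erase (orderedPoint s i)) j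

lemma measurableSet_pairEvent (i j : ℕ) : MeasurableSet (pairEvent i j) :=
  (measurableSet_lt_card i).inter
    ((by fun_prop : Measurable fun s : Finset ℝ => s.erase (orderedPoint s i))
      (measurableSet_lt_card j))

@[fun_prop]
lemma measurable_orderedPartner (i j : ℕ) : Measurable fun s => orderedPartner s i j := by
  unfold orderedPartner
  fun_prop

lemma lintegral_sum_sum_erase_config (hS : Measurable S) {f : α → ℝ → ℝ → ℝ≥0∞}
    (hf : ∀ i j, AEMeasurable (fun a => f a (orderedPoint (S a) i) (orderedPartner (S a) i j))
      (μ.restrict (S ⁻¹' pairEvent i j))) :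
    ∫⁻ a, ∑ x ∈ S a, ∑ y ∈ (S a).erase x, f a x y ∂μ = ∑' i, ∑' j,
      ∫⁻ a in S ⁻¹' pairEvent i j, f a (orderedPoint (S a) i) (orderedPartner (S a) i j) ∂μ := by
  have herase : ∀ i, Measurable fun a => (S a).erase (orderedPoint (S a) i) := fun i => by
    fun_prop
  have hrestrict : ∀ i j, (μ.restrict {a | i < (S a).card}).restrict
      {a | j < ((S a).erase (orderedPoint (S a) i)).card} =
        μ.restrict (S ⁻¹' pairEvent i j) := fun i j =>
    (Measure.restrict_restrict (herase i (measurableSet_lt_card j))).trans <| by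
      rw [Set.inter_comm]
      rfl
  have hf' : ∀ i j, AEMeasurable
      (fun a => f a (orderedPoint (S a) i) (orderedPoint ((S a).erase (orderedPoint (S a) i)) j))
      ((μ.restrict {a | i < (S a).card}).restrict
        {a | j < ((S a).erase (orderedPoint (S a) i)).card}) :=
    fun i j => (hrestrict i j).symm ▸ hf i j
  rw [lintegral_sum_config hS fun i => aemeasurable_sum_config (herase i) (hf' i)]
  refine tsum_congr fun i => ?_
  rw [lintegral_sum_config (herase i) (hf' i)]
  exact tsum_congr fun j => by rw [hrestrict]; rfl

lemma lintegral_eq_tsum_fiber {ι : Type*} [Countable ι] [MeasurableSpace ι]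
    [MeasurableSingletonClass ι] {n : α → ι} (hn : Measurable n) (g : α → ℝ≥0∞) :
    ∫⁻ a, g a ∂μ = ∑' k, ∫⁻ a in {a | n a = k}, g a ∂μ := by
  rw [← lintegral_iUnion (s := fun k => {a | n a = k})
    (fun k => hn (MeasurableSet.singleton k)), ← setLIntegral_univ]
  · congr 2
    ext a
    simp
  · exact fun i j hij => Set.disjoint_left.2 fun a hi hj => hij (hi.symm.trans hj)

end EnumeratedSums

section PoissonProcess

lemma succ_mul_poissonMeasure_succ (r : NNReal) (n : ℕ) :
    ((n + 1 : ℕ) : ℝ≥0∞) * poissonMeasure r {n + 1} = r * poissonMeasure r {n} := by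
  rw [poissonMeasure_singleton, poissonMeasure_singleton, ← ENNReal.ofReal_natCast,
    ← ENNReal.ofReal_coe_nnreal, ← ENNReal.ofReal_mul (by positivity),
    ← ENNReal.ofReal_mul (by positivity), Nat.factorial_succ]
  congr 1
  push_cast
  field_simp
  ring

lemma lintegral_natCast_poissonMeasure (r : NNReal) :
    ∫⁻ n, (n : ℝ≥0∞) ∂(poissonMeasure r) = r := by
  have htotal : ∑' n, poissonMeasure r {n} = 1 := by
    rw [← measure_univ (μ := poissonMeasure r), ← lintegral_one, lintegral_countable']
    simp only [one_mul]
  rw [lintegral_countable', tsum_eq_zero_add' ENNReal.summable]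
  simp only [succ_mul_poissonMeasure_succ, ENNReal.tsum_mul_left, htotal, Nat.cast_zero, zero_mul,
    zero_add, mul_one]

lemma sum_mul_prod_erase_of_card {α R : Type*} [DecidableEq α] [CommSemiring R] (v : α → R) (n : ℕ)
    (s : Finset α) :
    ∑ x ∈ s, v x * (if (s.erase x).card = n then ∏ y ∈ s.erase x, v y else 0) =
      if s.card = n + 1 then ((n + 1 : ℕ) : R) * ∏ y ∈ s, v y else 0 := by
  have hterm : ∀ x ∈ s, v x * (if (s.erase x).card = n then ∏ y ∈ s.erase x, v y else 0) =
      if s.card = n + 1 then ∏ y ∈ s, v y else 0 := fun x hx => by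
    simp only [← Finset.card_erase_add_one hx, Nat.add_right_cancel_iff, mul_ite, mul_zero,
      Finset.mul_prod_erase s v hx]
  rw [Finset.sum_congr rfl hterm, Finset.sum_const, nsmul_eq_mul, mul_ite, mul_zero]
  exact ite_congr rfl (fun hs => by rw [hs]) fun _ => rfl

/-- The reduced Campbell measure of a law `Q` of finite configurations, the expected number of
pairs `(x, s \ {x})` with `x` a point of the random configuration `s`. Mecke's formula computes it
for the Poisson process. -/
def campbellMeasure (Q : Measure (Finset ℝ)) : Measure (ℝ × Finset ℝ) :=
  Measure.sum fun i : ℕ => (Q.restrict {s | i < s.card}).map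
    fun s => (orderedPoint s i, s.erase (orderedPoint s i))

lemma lintegral_campbellMeasure (Q : Measure (Finset ℝ)) {F : ℝ × Finset ℝ → ℝ≥0∞}
    (hF : Measurable F) :
    ∫⁻ p, F p ∂(campbellMeasure Q) = ∫⁻ s, ∑ x ∈ s, F (x, s.erase x) ∂Q := by
  have hpoint : ∀ i : ℕ, Measurable fun s : Finset ℝ =>
      (orderedPoint s i, s.erase (orderedPoint s i)) := fun i => by fun_prop
  rw [campbellMeasure, lintegral_sum_measure, lintegral_sum_config (S := fun s => s) measurable_id
    fun i => (hF.comp (hpoint i)).aemeasurable]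
  exact tsum_congr fun i => lintegral_map hF (hpoint i)

open Classical in
lemma sum_indicator_prod_voidEvent (A B : Set ℝ) (s : Finset ℝ) :
    ∑ x ∈ s, (B ×ˢ voidEvent A).indicator (1 : ℝ × Finset ℝ → ℝ≥0∞) (x, s.erase x) =
      ∑ x ∈ s.filter (· ∈ B), if configCount A (s.erase x) = 0 then 1 else 0 := by
  rw [Finset.sum_filter]
  refine Finset.sum_congr rfl fun x _ => ?_
  simp only [Set.indicator_apply, Set.mem_prod, mem_voidEvent, Pi.one_apply, ite_and]

lemma sum_indicator_prod_voidEvent_of_disjoint {A B : Set ℝ} (hAB : Disjoint A B)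
    (s : Finset ℝ) :
    ∑ x ∈ s, (B ×ˢ voidEvent A).indicator (1 : ℝ × Finset ℝ → ℝ≥0∞) (x, s.erase x) =
      (if configCount A s = 0 then 1 else 0) * configCount B s := by
  classical
  have herase : ∀ x ∈ s.filter (· ∈ B), configCount A (s.erase x) = configCount A s := fun x hx =>
    have hxA : x ∉ A := hAB.notMem_of_mem_right (Finset.mem_filter.1 hx).2
    by simp [configCount_erase, hxA]
  rw [sum_indicator_prod_voidEvent, Finset.sum_congr rfl fun x hx => by rw [herase x hx],
    Finset.sum_const, nsmul_eq_mul, mul_comm]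
  rfl

lemma sum_indicator_prod_voidEvent_of_subset {A B : Set ℝ} (hBA : B ⊆ A) (s : Finset ℝ) :
    ∑ x ∈ s, (B ×ˢ voidEvent A).indicator (1 : ℝ × Finset ℝ → ℝ≥0∞) (x, s.erase x) =
      (if configCount B s = 1 then 1 else 0) * if configCount (A \ B) s = 0 then 1 else 0 := by
  classical
  have herase : ∀ x ∈ s.filter (· ∈ B), configCount A (s.erase x) = configCount A s - 1 :=
    fun x hx => by
      obtain ⟨hxs, hxB⟩ := Finset.mem_filter.1 hx
      simp [configCount_erase, hxs, hBA hxB]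
  have hsplit : configCount B s + configCount (A \ B) s = configCount A s := by
    simpa only [Set.inter_eq_right.2 hBA] using configCount_inter_add_diff A B s
  rw [sum_indicator_prod_voidEvent, Finset.sum_congr rfl fun x hx => by rw [herase x hx],
    Finset.sum_const, nsmul_eq_mul]
  change (configCount B s : ℝ≥0∞) * _ = _
  obtain hB | hB | hB : configCount B s = 0 ∨ configCount B s = 1 ∨ 1 < configCount B s := by omega
  · simp [hB]
  · simp [← hsplit, hB]
  · have hA : configCount A s - 1 ≠ 0 := by omega
    simp [hA, hB.ne']

end PoissonProcess

namespace IsUnitPoissonProcess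

variable {Ω : Type*} [MeasurableSpace Ω] {P : Measure Ω} {L : ℝ} {Φ : Ω → Finset ℝ} {A B : Set ℝ}
  {v : ℝ → ℝ≥0∞}

lemma measurable_config (h : IsUnitPoissonProcess P L Φ) : Measurable Φ :=
  measurable_of_measurable_configCount fun B hB =>
    pointCount_eq_configCount Φ B ▸ h.measurable_count B hB

lemma map_configCount (h : IsUnitPoissonProcess P L Φ) (hB : MeasurableSet B) :
    P.map (fun ω => configCount B (Φ ω)) =
      poissonMeasure (volume.restrict (Set.Icc 0 L) B).toNNReal := by
  rw [← pointCount_eq_configCount, h.count_law B hB, Measure.restrict_apply hB]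

lemma isProbabilityMeasure (h : IsUnitPoissonProcess P L Φ) : IsProbabilityMeasure P :=
  have : IsProbabilityMeasure (P.map (pointCount Φ Set.univ)) := by
    rw [h.count_law _ MeasurableSet.univ]
    infer_instance
  Measure.isProbabilityMeasure_of_map (pointCount Φ Set.univ)

lemma measurable_configCount (h : IsUnitPoissonProcess P L Φ) (hB : MeasurableSet B) :
    Measurable fun ω => configCount B (Φ ω) :=
  (_root_.measurable_configCount hB).comp h.measurable_config

lemma measurableSet_configCount_eq (h : IsUnitPoissonProcess P L Φ) (hB : MeasurableSet B)
    (k : ℕ) : MeasurableSet {ω | configCount B (Φ ω) = k} :=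
  h.measurable_configCount hB (MeasurableSet.singleton k)

lemma measure_configCount_eq (h : IsUnitPoissonProcess P L Φ) (hB : MeasurableSet B) (k : ℕ) :
    P {ω | configCount B (Φ ω) = k} =
      poissonMeasure (volume.restrict (Set.Icc 0 L) B).toNNReal {k} := by
  rw [← h.map_configCount hB, Measure.map_apply (h.measurable_configCount hB)
    (MeasurableSet.singleton k)]
  rfl

lemma measure_configCount_eq_one (h : IsUnitPoissonProcess P L Φ) (hB : MeasurableSet B) :
    P {ω | configCount B (Φ ω) = 1} =
      volume.restrict (Set.Icc 0 L) B * P {ω | configCount B (Φ ω) = 0} := by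
  rw [h.measure_configCount_eq hB, h.measure_configCount_eq hB]
  have hsucc := succ_mul_poissonMeasure_succ (volume.restrict (Set.Icc 0 L) B).toNNReal 0
  rwa [zero_add, Nat.cast_one, one_mul, ENNReal.coe_toNNReal (measure_ne_top _ _)] at hsucc

lemma lintegral_configCount (h : IsUnitPoissonProcess P L Φ) (hB : MeasurableSet B) :
    ∫⁻ ω, (configCount B (Φ ω) : ℝ≥0∞) ∂P = volume.restrict (Set.Icc 0 L) B := by
  rw [← lintegral_map (f := fun n : ℕ => (n : ℝ≥0∞)) (measurable_of_countable _)
    (h.measurable_configCount hB), h.map_configCount hB, lintegral_natCast_poissonMeasure,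
    ENNReal.coe_toNNReal (measure_ne_top _ _)]

lemma indepFun_configCount (h : IsUnitPoissonProcess P L Φ) (hA : MeasurableSet A)
    (hB : MeasurableSet B) (hAB : Disjoint A B) :
    IndepFun (fun ω => configCount A (Φ ω)) (fun ω => configCount B (Φ ω)) P := by
  have hdisjoint : Pairwise fun i j => Disjoint (![A, B] i) (![A, B] j) := by
    simp [Pairwise, Fin.forall_fin_two, hAB, hAB.symm]
  have hindep := (h.count_indep 2 ![A, B] (by simp [Fin.forall_fin_two, hA, hB]) hdisjoint).indepFun
    (i := 0) (j := 1) (by decide)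
  rwa [pointCount_eq_configCount, pointCount_eq_configCount] at hindep

lemma lintegral_mul_configCount (h : IsUnitPoissonProcess P L Φ) (hA : MeasurableSet A)
    (hB : MeasurableSet B) (hAB : Disjoint A B) (f g : ℕ → ℝ≥0∞) :
    ∫⁻ ω, f (configCount A (Φ ω)) * g (configCount B (Φ ω)) ∂P =
      (∫⁻ ω, f (configCount A (Φ ω)) ∂P) * ∫⁻ ω, g (configCount B (Φ ω)) ∂P :=
  have hf : Measurable f := measurable_of_countable f
  have hg : Measurable g := measurable_of_countable g
  lintegral_mul_eq_lintegral_mul_lintegral_of_indepFun (hf.comp (h.measurable_configCount hA))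
    (hg.comp (h.measurable_configCount hB)) ((h.indepFun_configCount hA hB hAB).comp hf hg)

lemma lintegral_ite_configCount_eq (h : IsUnitPoissonProcess P L Φ) (hB : MeasurableSet B)
    (k : ℕ) :
    ∫⁻ ω, (if configCount B (Φ ω) = k then 1 else 0) ∂P = P {ω | configCount B (Φ ω) = k} := by
  rw [← lintegral_indicator_one (h.measurableSet_configCount_eq hB k)]
  simp only [Set.indicator_apply, Set.mem_ofPred_eq, Pi.one_apply]

lemma measure_voidEvent_union (h : IsUnitPoissonProcess P L Φ) (hA : MeasurableSet A)
    (hB : MeasurableSet B) (hAB : Disjoint A B) :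
    P {ω | configCount (A ∪ B) (Φ ω) = 0} =
      P {ω | configCount A (Φ ω) = 0} * P {ω | configCount B (Φ ω) = 0} := by
  have hunion : {ω | configCount (A ∪ B) (Φ ω) = 0} =
      {ω | configCount A (Φ ω) = 0} ∩ {ω | configCount B (Φ ω) = 0} :=
    congrArg (Φ ⁻¹' ·) (voidEvent_union A B)
  rw [hunion]
  exact (h.indepFun_configCount hA hB hAB).measure_inter_preimage_eq_mul _ _
    (MeasurableSet.singleton 0) (MeasurableSet.singleton 0)

lemma campbellMeasure_prod_voidEvent (h : IsUnitPoissonProcess P L Φ) (hA : MeasurableSet A)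
    (hB : MeasurableSet B) :
    campbellMeasure (P.map Φ) (B ×ˢ voidEvent A) = ∫⁻ ω, ∑ x ∈ Φ ω,
      (B ×ˢ voidEvent A).indicator (1 : ℝ × Finset ℝ → ℝ≥0∞) (x, (Φ ω).erase x) ∂P := by
  have hrect : MeasurableSet (B ×ˢ voidEvent A) := hB.prod (measurableSet_voidEvent hA)
  have hind : Measurable ((B ×ˢ voidEvent A).indicator (1 : ℝ × Finset ℝ → ℝ≥0∞)) :=
    measurable_one.indicator hrect
  rw [← lintegral_indicator_one hrect, lintegral_campbellMeasure _ hind,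
    lintegral_map _ h.measurable_config]
  refine measurable_sum_config measurable_id (f := fun s x => (B ×ˢ voidEvent A).indicator _ _) ?_
  exact hind.comp (by fun_prop)

lemma map_voidEvent (h : IsUnitPoissonProcess P L Φ) (hA : MeasurableSet A) :
    P.map Φ (voidEvent A) = P {ω | configCount A (Φ ω) = 0} :=
  Measure.map_apply h.measurable_config (measurableSet_voidEvent hA)

lemma campbellMeasure_prod_voidEvent_of_disjoint (h : IsUnitPoissonProcess P L Φ)
    (hA : MeasurableSet A) (hB : MeasurableSet B) (hAB : Disjoint A B) :
    campbellMeasure (P.map Φ) (B ×ˢ voidEvent A) =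
      volume.restrict (Set.Icc 0 L) B * P.map Φ (voidEvent A) := by
  rw [h.campbellMeasure_prod_voidEvent hA hB]
  simp only [sum_indicator_prod_voidEvent_of_disjoint hAB]
  rw [h.lintegral_mul_configCount hA hB hAB (fun n => if n = 0 then 1 else 0) (fun n => n),
    h.lintegral_ite_configCount_eq hA, h.lintegral_configCount hB, h.map_voidEvent hA, mul_comm]

lemma campbellMeasure_prod_voidEvent_of_subset (h : IsUnitPoissonProcess P L Φ)
    (hA : MeasurableSet A) (hB : MeasurableSet B) (hBA : B ⊆ A) :
    campbellMeasure (P.map Φ) (B ×ˢ voidEvent A) =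
      volume.restrict (Set.Icc 0 L) B * P.map Φ (voidEvent A) := by
  have hAB : MeasurableSet (A \ B) := hA.diff hB
  rw [h.campbellMeasure_prod_voidEvent hA hB]
  simp only [sum_indicator_prod_voidEvent_of_subset hBA]
  rw [h.lintegral_mul_configCount hB hAB Set.disjoint_sdiff_right
      (fun n => if n = 1 then 1 else 0) (fun n => if n = 0 then 1 else 0),
    h.lintegral_ite_configCount_eq hB, h.lintegral_ite_configCount_eq hAB,
    h.measure_configCount_eq_one hB, mul_assoc,
    ← h.measure_voidEvent_union hB hAB Set.disjoint_sdiff_right, Set.union_sdiff_cancel hBA,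
    h.map_voidEvent hA]

lemma campbellMeasure_eq (h : IsUnitPoissonProcess P L Φ) :
    campbellMeasure (P.map Φ) = (volume.restrict (Set.Icc 0 L)).prod (P.map Φ) := by
  have := h.isProbabilityMeasure
  have := Measure.isProbabilityMeasure_map (μ := P) h.measurable_config.aemeasurable
  refine (Measure.prod_eq_generateFrom (C := {s | MeasurableSet s}) (D := voidEvents)
    MeasurableSpace.generateFrom_measurableSet generateFrom_voidEvents
    MeasurableSpace.isPiSystem_measurableSet isPiSystem_voidEvents
    (Measure.toFiniteSpanningSetsIn _)
    ⟨fun _ => Set.univ, fun _ => ⟨∅, MeasurableSet.empty, by ext; simp [voidEvent, configCount]⟩,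
      fun _ => measure_lt_top _ _, Set.iUnion_const _⟩ ?_).symm
  rintro B (hB : MeasurableSet B) _ ⟨A, hA, rfl⟩
  have hdisjoint : Disjoint ((B ∩ A) ×ˢ voidEvent A) ((B \ A) ×ˢ voidEvent A) :=
    Set.disjoint_prod.2 (Or.inl Set.disjoint_sdiff_inter.symm)
  conv_lhs => rw [← Set.inter_union_sdiff B A]
  rw [Set.union_prod, measure_union hdisjoint ((hB.diff hA).prod (measurableSet_voidEvent hA)),
    h.campbellMeasure_prod_voidEvent_of_subset hA (hB.inter hA) Set.inter_subset_right,
    h.campbellMeasure_prod_voidEvent_of_disjoint hA (hB.diff hA) Set.disjoint_sdiff_right,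
    ← add_mul, measure_inter_add_sdiff B hA]

theorem mecke (h : IsUnitPoissonProcess P L Φ) {F : ℝ → Finset ℝ → ℝ≥0∞}
    (hF : Measurable (Function.uncurry F)) :
    ∫⁻ ω, ∑ x ∈ Φ ω, F x ((Φ ω).erase x) ∂P = ∫⁻ x in Set.Icc 0 L, ∫⁻ ω, F x (Φ ω) ∂P := by
  have := h.isProbabilityMeasure
  have := Measure.isProbabilityMeasure_map (μ := P) h.measurable_config.aemeasurable
  have hsum : Measurable fun s : Finset ℝ => ∑ x ∈ s, F x (s.erase x) :=
    measurable_sum_config measurable_id (hF.comp (by fun_prop : Measurable fun p : Finset ℝ × ℝ =>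
      (p.2, p.1.erase p.2)))
  calc ∫⁻ ω, ∑ x ∈ Φ ω, F x ((Φ ω).erase x) ∂P
      = ∫⁻ s, ∑ x ∈ s, F x (s.erase x) ∂(P.map Φ) := (lintegral_map hsum h.measurable_config).symm
    _ = ∫⁻ p, Function.uncurry F p ∂(campbellMeasure (P.map Φ)) :=
        (lintegral_campbellMeasure _ hF).symm
    _ = ∫⁻ x in Set.Icc 0 L, ∫⁻ s, F x s ∂(P.map Φ) := by
        rw [h.campbellMeasure_eq, MeasureTheory.lintegral_prod _ hF.aemeasurable]
        rfl
    _ = ∫⁻ x in Set.Icc 0 L, ∫⁻ ω, F x (Φ ω) ∂P := lintegral_congr fun x =>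
        lintegral_map (hF.comp measurable_prodMk_left) h.measurable_config

theorem mecke_pairs (h : IsUnitPoissonProcess P L Φ) {F : ℝ → ℝ → Finset ℝ → ℝ≥0∞}
    (hF : Measurable fun p : ℝ × ℝ × Finset ℝ => F p.1 p.2.1 p.2.2) :
    ∫⁻ ω, ∑ x ∈ Φ ω, ∑ y ∈ (Φ ω).erase x, F x y (((Φ ω).erase x).erase y) ∂P =
      ∫⁻ x in Set.Icc 0 L, ∫⁻ y in Set.Icc 0 L, ∫⁻ ω, F x y (Φ ω) ∂P := by
  have hinner : Measurable (Function.uncurry fun x s => ∑ y ∈ s, F x y (s.erase y)) :=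
    measurable_sum_config measurable_snd (f := fun p y => F p.1 y (p.2.erase y))
      (hF.comp (by fun_prop : Measurable fun q : (ℝ × Finset ℝ) × ℝ =>
        (q.1.1, q.2, q.1.2.erase q.2)))
  rw [h.mecke hinner]
  exact lintegral_congr fun x => h.mecke (hF.comp measurable_prodMk_left)

lemma measurableSet_card_eq (h : IsUnitPoissonProcess P L Φ) (n : ℕ) :
    MeasurableSet {ω | (Φ ω).card = n} :=
  (measurable_finset_card.comp h.measurable_config) (MeasurableSet.singleton n)

lemma measure_card_eq_zero (h : IsUnitPoissonProcess P L Φ) :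
    P {ω | (Φ ω).card = 0} = ENNReal.ofReal (Real.exp (-volume.real (Set.Icc 0 L))) := by
  simp only [← configCount_univ]
  rw [h.measure_configCount_eq MeasurableSet.univ, poissonMeasure_singleton]
  simp only [Measure.restrict_apply_univ, ENNReal.coe_toNNReal_eq_toReal, pow_zero, mul_one,
    Nat.factorial_zero, Nat.cast_one, div_one, Measure.real]

lemma measurable_prod (h : IsUnitPoissonProcess P L Φ) (hv : Measurable v) :
    Measurable fun ω => ∏ x ∈ Φ ω, v x :=
  measurable_prod_config h.measurable_config (f := fun _ x => v x) (hv.comp measurable_snd)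

lemma succ_mul_setLIntegral_prod_succ (h : IsUnitPoissonProcess P L Φ) (hv : Measurable v)
    (n : ℕ) :
    ((n + 1 : ℕ) : ℝ≥0∞) * ∫⁻ ω in {ω | (Φ ω).card = n + 1}, ∏ x ∈ Φ ω, v x ∂P =
      (∫⁻ x in Set.Icc 0 L, v x) * ∫⁻ ω in {ω | (Φ ω).card = n}, ∏ x ∈ Φ ω, v x ∂P := by
  set g : Finset ℝ → ℝ≥0∞ := fun s => if s.card = n then ∏ y ∈ s, v y else 0
  have hg : Measurable g := Measurable.ite (measurable_finset_card (MeasurableSet.singleton n))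
    (measurable_prod_config measurable_id (f := fun _ x => v x) (hv.comp measurable_snd))
    measurable_const
  have hite : ∀ (k : ℕ) (f : Ω → ℝ≥0∞), ∫⁻ ω, (if (Φ ω).card = k then f ω else 0) ∂P =
      ∫⁻ ω in {ω | (Φ ω).card = k}, f ω ∂P := fun k f => by
    rw [← lintegral_indicator (h.measurableSet_card_eq k)]
    simp only [Set.indicator_apply, Set.mem_ofPred_eq]
  calc ((n + 1 : ℕ) : ℝ≥0∞) * ∫⁻ ω in {ω | (Φ ω).card = n + 1}, ∏ x ∈ Φ ω, v x ∂P
      = ∫⁻ ω, ∑ x ∈ Φ ω, v x * g ((Φ ω).erase x) ∂P := by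
        rw [← lintegral_const_mul _ (h.measurable_prod hv), ← hite]
        exact lintegral_congr fun ω => (sum_mul_prod_erase_of_card v n (Φ ω)).symm
    _ = ∫⁻ x in Set.Icc 0 L, ∫⁻ ω, v x * g (Φ ω) ∂P :=
        h.mecke (F := fun x s => v x * g s)
          ((hv.comp measurable_fst).mul (hg.comp measurable_snd))
    _ = (∫⁻ x in Set.Icc 0 L, v x) * ∫⁻ ω in {ω | (Φ ω).card = n}, ∏ x ∈ Φ ω, v x ∂P := by
        have hgΦ : Measurable fun ω => g (Φ ω) := hg.comp h.measurable_config
        simp only [lintegral_const_mul _ hgΦ]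
        rw [lintegral_mul_const _ hv]
        simp only [g, hite]

lemma setLIntegral_prod_card_eq (h : IsUnitPoissonProcess P L Φ) (hv : Measurable v)
    (hv_fin : ∫⁻ x in Set.Icc 0 L, v x ≠ ∞) (n : ℕ) :
    ∫⁻ ω in {ω | (Φ ω).card = n}, ∏ x ∈ Φ ω, v x ∂P =
      ENNReal.ofReal (Real.exp (-volume.real (Set.Icc 0 L)) *
        ((∫⁻ x in Set.Icc 0 L, v x).toReal ^ n / n.factorial)) := by
  induction n with
  | zero =>
    calc ∫⁻ ω in {ω | (Φ ω).card = 0}, ∏ x ∈ Φ ω, v x ∂P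
        = ∫⁻ _ in {ω | (Φ ω).card = 0}, 1 ∂P :=
          setLIntegral_congr_fun (h.measurableSet_card_eq 0) fun _ hω => by
            simp [Finset.card_eq_zero.1 hω]
      _ = _ := by
        rw [setLIntegral_one, h.measure_card_eq_zero, pow_zero, Nat.factorial_zero, Nat.cast_one,
          div_one, mul_one]
  | succ n ih =>
    have hsucc := h.succ_mul_setLIntegral_prod_succ hv n
    rw [ih] at hsucc
    rw [← ENNReal.mul_right_inj (by simp) (ENNReal.natCast_ne_top (n + 1)), hsucc,
      ← ENNReal.ofReal_toReal hv_fin, ← ENNReal.ofReal_natCast,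
      ← ENNReal.ofReal_mul (by positivity), ← ENNReal.ofReal_mul (by positivity),
      ENNReal.ofReal_toReal hv_fin, Nat.factorial_succ]
    congr 1
    push_cast
    field_simp
    ring

lemma lintegral_prod_eq_exp (h : IsUnitPoissonProcess P L Φ) (hv : Measurable v)
    (hv_fin : ∫⁻ x in Set.Icc 0 L, v x ≠ ∞) :
    ∫⁻ ω, ∏ x ∈ Φ ω, v x ∂P = ENNReal.ofReal (Real.exp
      ((∫⁻ x in Set.Icc 0 L, v x).toReal - volume.real (Set.Icc 0 L))) := by
  set V := (∫⁻ x in Set.Icc 0 L, v x).toReal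
  have hexp := (NormedSpace.expSeries_div_hasSum_exp V).mul_left
    (Real.exp (-volume.real (Set.Icc 0 L)))
  rw [lintegral_eq_tsum_fiber (measurable_finset_card.comp h.measurable_config)]
  simp only [Function.comp_apply, h.setLIntegral_prod_card_eq hv hv_fin]
  rw [← ENNReal.ofReal_tsum_of_nonneg (fun n => by positivity) hexp.summable, hexp.tsum_eq,
    ← Real.exp_eq_exp_ℝ, ← Real.exp_add, neg_add_eq_sub]

theorem lintegral_prod_one_sub (h : IsUnitPoissonProcess P L Φ) {u : ℝ → ℝ≥0∞}
    (hu : Measurable u) (hu_le : ∀ x ∈ Set.Icc 0 L, u x ≤ 1) :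
    ∫⁻ ω, ∏ x ∈ Φ ω, (1 - u x) ∂P =
      ENNReal.ofReal (Real.exp (-(∫⁻ x in Set.Icc 0 L, u x).toReal)) := by
  have hle : ∀ᵐ x ∂volume.restrict (Set.Icc 0 L), u x ≤ 1 :=
    ae_restrict_of_forall_mem measurableSet_Icc hu_le
  have hu_fin : ∫⁻ x in Set.Icc 0 L, u x ≠ ∞ :=
    ((lintegral_mono_ae hle).trans_lt (by simp)).ne
  have hsub : ∫⁻ x in Set.Icc 0 L, (1 - u x) = volume (Set.Icc 0 L) - ∫⁻ x in Set.Icc 0 L, u x := by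
    rw [lintegral_sub hu hu_fin hle, setLIntegral_one]
  have hu_le_volume : ∫⁻ x in Set.Icc 0 L, u x ≤ volume (Set.Icc 0 L) :=
    (lintegral_mono_ae hle).trans_eq (setLIntegral_one _)
  rw [h.lintegral_prod_eq_exp (by fun_prop : Measurable fun x => 1 - u x)
      (hsub ▸ ENNReal.sub_ne_top (by simp)), hsub,
    ENNReal.toReal_sub_of_le hu_le_volume (by simp), Measure.real, sub_sub_cancel_left]

end IsUnitPoissonProcess

section Edges

lemma torusDist_nonneg {L x y : ℝ} (hx : x ∈ Set.Icc 0 L) (hy : y ∈ Set.Icc 0 L) :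
    0 ≤ torusDist L x y :=
  le_min (abs_nonneg _) (sub_nonneg.2 (by simpa using abs_sub_le_of_le_of_le hx.1 hx.2 hy.1 hy.2))

lemma measurable_torusDist (L : ℝ) : Measurable (Function.uncurry (torusDist L)) := by
  unfold torusDist Function.uncurry
  fun_prop

/-- A connection function gives connection probabilities in `[0, 1]` as a measurable function of
the distance; its values at negative arguments are irrelevant. -/
structure IsConnectionFunction (H : ℝ → ℝ) : Prop where
  measurable : Measurable H
  nonneg : ∀ r, 0 ≤ r → 0 ≤ H r
  le_one : ∀ r, 0 ≤ r → H r ≤ 1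

/-- The probability `H (ρ(x, y))` that the nodes `x` and `y` are joined by an edge. -/
def connProb (H : ℝ → ℝ) (L x y : ℝ) : ℝ≥0∞ := ENNReal.ofReal (H (torusDist L x y))

namespace IsConnectionFunction

variable {H : ℝ → ℝ}

lemma measurable_connProb (hH : IsConnectionFunction H) (L : ℝ) :
    Measurable (Function.uncurry (connProb H L)) :=
  (hH.measurable.comp (measurable_torusDist L)).ennreal_ofReal

lemma measurable_connProb_comp (hH : IsConnectionFunction H) (L : ℝ) {α : Type*}
    [MeasurableSpace α] {f g : α → ℝ} (hf : Measurable f) (hg : Measurable g) :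
    Measurable fun a => connProb H L (f a) (g a) :=
  (hH.measurable_connProb L).comp (hf.prodMk hg)

lemma connProb_le_one (hH : IsConnectionFunction H) {L x y : ℝ} (hx : x ∈ Set.Icc 0 L)
    (hy : y ∈ Set.Icc 0 L) : connProb H L x y ≤ 1 :=
  ENNReal.ofReal_le_one.2 (hH.le_one _ (torusDist_nonneg hx hy))

end IsConnectionFunction

variable {Ω ι : Type*} {Φ : Ω → Finset ℝ} {A : Set Ω}

/-- The selections of pairs of nodes to which the field `IsSoftRGG.edges` applies, over an arbitrary
index type: the event `A` and the nodes `x i`, `y i` are determined by the configuration, and on `A`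
the pairs `{x i, y i}` are different pairs of distinct nodes. -/
structure IsPairSelection (Φ : Ω → Finset ℝ) (A : Set Ω) (x y : ι → Ω → ℝ) : Prop where
  measurableSet : MeasurableSet[configSigma Φ] A
  measurable_fst : ∀ i, Measurable[configSigma Φ] (x i)
  measurable_snd : ∀ i, Measurable[configSigma Φ] (y i)
  mem_fst : ∀ ω ∈ A, ∀ i, x i ω ∈ Φ ω
  mem_snd : ∀ ω ∈ A, ∀ i, y i ω ∈ Φ ω
  ne : ∀ ω ∈ A, ∀ i, x i ω ≠ y i ω
  injective : ∀ ω ∈ A, Function.Injective fun i => s(x i ω, y i ω)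

/-- The event that `A` occurs, all pairs selected by `T` are edges, and none of those selected by
`S` is. -/
def edgePattern (G : Ω → SimpleGraph ℝ) (A : Set Ω) (x y : ι → Ω → ℝ) (T S : Finset ι) : Set Ω :=
  {ω | ω ∈ A ∧ (∀ i ∈ T, (G ω).Adj (x i ω) (y i ω)) ∧ ∀ i ∈ S, ¬ (G ω).Adj (x i ω) (y i ω)}

lemma edgePattern_insert_right [DecidableEq ι] (G : Ω → SimpleGraph ℝ) (A : Set Ω)
    (x y : ι → Ω → ℝ) (T S : Finset ι) (a : ι) : edgePattern G A x y T (insert a S) =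
      edgePattern G A x y T S \ edgePattern G A x y (insert a T) S := by
  ext ω
  simp only [edgePattern, Finset.forall_mem_insert, Set.mem_sdiff, Set.mem_ofPred_eq]
  tauto

lemma edgePattern_insert_left_subset [DecidableEq ι] (G : Ω → SimpleGraph ℝ) (A : Set Ω)
    (x y : ι → Ω → ℝ) (T S : Finset ι) (a : ι) :
    edgePattern G A x y (insert a T) S ⊆ edgePattern G A x y T S :=
  fun _ hω => ⟨hω.1, fun i hi => hω.2.1 i (Finset.mem_insert_of_mem hi), hω.2.2⟩

lemma forall_forall_mem_iff_forall_sigma {S : ι → Finset ℝ} {k : ι → ℕ}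
    (hk : ∀ j, (S j).card = k j) {q : ι → ℝ → Prop} :
    (∀ j, ∀ y ∈ S j, q j y) ↔ ∀ p : Σ j, Fin (k j), q p.1 (orderedPoint (S p.1) p.2) := by
  simp only [mem_iff_exists_orderedPoint, hk, Sigma.forall, Fin.forall_iff, forall_exists_index,
    and_imp, forall_apply_eq_imp_iff₂]

lemma prod_prod_eq_prod_sigma {M : Type*} [Fintype ι] [CommMonoid M] {S : ι → Finset ℝ}
    {k : ι → ℕ} (hk : ∀ j, (S j).card = k j) (f : ι → ℝ → M) :
    ∏ j, ∏ y ∈ S j, f j y = ∏ p : Σ j, Fin (k j), f p.1 (orderedPoint (S p.1) p.2) := by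
  rw [Fintype.prod_sigma]
  refine Finset.prod_congr rfl fun j _ => ?_
  rw [prod_eq_prod_range_orderedPoint, hk, Finset.prod_range]

/-- Finitely many stars whose centres `X j` and sets of leaves `S j` are determined by the
configuration, and which on the event `A` consist of nodes and share no edge. -/
structure IsStarSelection (Φ : Ω → Finset ℝ) (A : Set Ω) (X : ι → Ω → ℝ)
    (S : ι → Ω → Finset ℝ) : Prop where
  measurableSet : MeasurableSet[configSigma Φ] A
  measurable_center : ∀ j, Measurable[configSigma Φ] (X j)
  measurable_leaves : ∀ j, Measurable[configSigma Φ] (S j)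
  center_mem : ∀ ω ∈ A, ∀ j, X j ω ∈ Φ ω
  leaves_subset : ∀ ω ∈ A, ∀ j, S j ω ⊆ Φ ω
  center_notMem : ∀ ω ∈ A, ∀ j, X j ω ∉ S j ω
  edge_ne : ∀ ω ∈ A, ∀ j j', j ≠ j' → ∀ y ∈ S j ω, ∀ y' ∈ S j' ω,
    s(X j ω, y) ≠ s(X j' ω, y')

/-- The event that `A` occurs and no centre is joined to a leaf of its star. -/
def noStarEdges (G : Ω → SimpleGraph ℝ) (A : Set Ω) (X : ι → Ω → ℝ) (S : ι → Ω → Finset ℝ) :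
    Set Ω :=
  {ω | ω ∈ A ∧ ∀ j, ∀ y ∈ S j ω, ¬ (G ω).Adj (X j ω) y}

lemma noStarEdges_eq_iUnion [Fintype ι] (G : Ω → SimpleGraph ℝ) (A : Set Ω) (X : ι → Ω → ℝ)
    (S : ι → Ω → Finset ℝ) :
    noStarEdges G A X S = ⋃ k : ι → ℕ, edgePattern G (A ∩ {ω | ∀ j, (S j ω).card = k j})
      (fun (p : Σ j, Fin (k j)) => X p.1) (fun p ω => orderedPoint (S p.1 ω) p.2) ∅
      Finset.univ := by
  ext ω
  simp only [Set.mem_iUnion, noStarEdges, edgePattern, Set.mem_ofPred_eq, Set.mem_inter_iff]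
  constructor
  · rintro ⟨hω, hnot⟩
    exact ⟨fun j => (S j ω).card, ⟨hω, fun _ => rfl⟩, by simp,
      fun p _ => (forall_forall_mem_iff_forall_sigma fun _ => rfl).1 hnot p⟩
  · rintro ⟨k, ⟨hω, hk⟩, -, hnot⟩
    exact ⟨hω, (forall_forall_mem_iff_forall_sigma hk).2 fun p => hnot p (Finset.mem_univ p)⟩

lemma measurableSet_forall_card_eq {α : Type*} {_ : MeasurableSpace α} [Countable ι]
    {S : ι → α → Finset ℝ} (hS : ∀ j, Measurable (S j)) (k : ι → ℕ) :
    MeasurableSet {a | ∀ j, (S j a).card = k j} := by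
  rw [Set.ofPred_forall]
  exact MeasurableSet.iInter fun j =>
    (measurable_finset_card.comp (hS j)) (MeasurableSet.singleton (k j))

lemma IsStarSelection.isPairSelection [Countable ι] {X : ι → Ω → ℝ} {S : ι → Ω → Finset ℝ}
    (h : IsStarSelection Φ A X S) (k : ι → ℕ) :
    IsPairSelection Φ (A ∩ {ω | ∀ j, (S j ω).card = k j})
      (fun (p : Σ j, Fin (k j)) => X p.1) fun p ω => orderedPoint (S p.1 ω) p.2 := by
  have hleaf : ∀ ω ∈ A ∩ {ω | ∀ j, (S j ω).card = k j}, ∀ p : Σ j, Fin (k j),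
      orderedPoint (S p.1 ω) p.2 ∈ S p.1 ω := fun ω hω p =>
    orderedPoint_mem ((hω.2 p.1).symm ▸ p.2.2)
  refine ⟨h.measurableSet.inter (measurableSet_forall_card_eq h.measurable_leaves k),
    fun p => h.measurable_center p.1,
    fun p => (measurable_orderedPoint p.2).comp (h.measurable_leaves p.1),
    fun ω hω p => h.center_mem ω hω.1 p.1,
    fun ω hω p => h.leaves_subset ω hω.1 p.1 (hleaf ω hω p),
    fun ω hω p hc => h.center_notMem ω hω.1 p.1 (hc ▸ hleaf ω hω p), fun ω hω p q hpq => ?_⟩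
  obtain hj | hj := ne_or_eq p.1 q.1
  · exact absurd hpq (h.edge_ne ω hω.1 _ _ hj _ (hleaf ω hω p) _ (hleaf ω hω q))
  obtain ⟨j, a⟩ := p
  obtain ⟨j, b⟩ := q
  obtain rfl : _ = j := hj
  have hcard : (S j ω).card = k j := hω.2 j
  have hab : (a : ℕ) = b := injOn_orderedPoint (S j ω) (by simp [hcard]) (by simp [hcard])
    (Sym2.congr_right.1 hpq)
  rw [Fin.ext hab]

end Edges

namespace IsSoftRGG

variable {Ω ι : Type*} [MeasurableSpace Ω] {P : Measure Ω} {L : ℝ} {H : ℝ → ℝ}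
  {Φ : Ω → Finset ℝ} {G : Ω → SimpleGraph ℝ} {A : Set Ω} {x y : ι → Ω → ℝ}

lemma configSigma_le (h : IsSoftRGG P L H Φ G) : configSigma Φ ≤ ‹MeasurableSpace Ω› := by
  rw [configSigma_eq_comap]
  exact h.nodes.measurable_config.comap_le

lemma measure_edgePattern_empty (h : IsSoftRGG P L H Φ G) (hxy : IsPairSelection Φ A x y)
    (T : Finset ι) :
    MeasurableSet (edgePattern G A x y T ∅) ∧ P (edgePattern G A x y T ∅) =
      ∫⁻ ω in A, ∏ i ∈ T, connProb H L (x i ω) (y i ω) ∂P := by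
  let e := T.equivFin
  have hset : edgePattern G A x y T ∅ =
      {ω | ω ∈ A ∧ ∀ k, (G ω).Adj (x (e.symm k) ω) (y (e.symm k) ω)} := by
    ext ω
    simp only [edgePattern, Finset.notMem_empty, false_imp_iff, imp_true_iff, and_true,
      Set.mem_ofPred_eq, e.symm.forall_congr_left, Subtype.forall, Equiv.symm_symm,
      Equiv.symm_apply_apply]
  obtain ⟨hmeas, hprob⟩ := h.edges T.card (fun k => x (e.symm k)) (fun k => y (e.symm k)) A
    hxy.measurableSet (fun k => hxy.measurable_fst _) (fun k => hxy.measurable_snd _)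
    (fun ω hω k => ⟨hxy.mem_fst ω hω _, hxy.mem_snd ω hω _, hxy.ne ω hω _⟩)
    (fun ω hω k l hkl hc => hkl (e.symm.injective (Subtype.ext (hxy.injective ω hω hc))))
  rw [hset]
  refine ⟨hmeas, hprob.trans (lintegral_congr fun ω => ?_)⟩
  rw [← Finset.prod_coe_sort T]
  exact e.symm.prod_comp fun i => connProb H L (x i ω) (y i ω)

lemma connProb_le_one_of_isPairSelection (h : IsSoftRGG P L H Φ G) (hH : IsConnectionFunction H)
    (hxy : IsPairSelection Φ A x y) {ω : Ω} (hω : ω ∈ A) (i : ι) :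
    connProb H L (x i ω) (y i ω) ≤ 1 :=
  hH.connProb_le_one (h.nodes.subset_Icc ω (hxy.mem_fst ω hω i))
    (h.nodes.subset_Icc ω (hxy.mem_snd ω hω i))

lemma lintegral_edgePattern_step [DecidableEq ι] (h : IsSoftRGG P L H Φ G)
    (hH : IsConnectionFunction H) (hxy : IsPairSelection Φ A x y) {S T : Finset ι} {a : ι}
    (haS : a ∉ S) (haT : a ∉ T) :
    (∫⁻ ω in A, (∏ i ∈ insert a T, connProb H L (x i ω) (y i ω)) *
        ∏ i ∈ S, (1 - connProb H L (x i ω) (y i ω)) ∂P) +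
      ∫⁻ ω in A, (∏ i ∈ T, connProb H L (x i ω) (y i ω)) *
        ∏ i ∈ insert a S, (1 - connProb H L (x i ω) (y i ω)) ∂P =
      ∫⁻ ω in A, (∏ i ∈ T, connProb H L (x i ω) (y i ω)) *
        ∏ i ∈ S, (1 - connProb H L (x i ω) (y i ω)) ∂P := by
  have hp : ∀ i, Measurable fun ω => connProb H L (x i ω) (y i ω) := fun i =>
    hH.measurable_connProb_comp L ((hxy.measurable_fst i).mono h.configSigma_le le_rfl)
      ((hxy.measurable_snd i).mono h.configSigma_le le_rfl)
  rw [← lintegral_add_left (by fun_prop)]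
  refine setLIntegral_congr_fun (h.configSigma_le _ hxy.measurableSet) fun ω hω => ?_
  have hcompl := add_tsub_cancel_of_le (h.connProb_le_one_of_isPairSelection hH hxy hω a)
  rw [Finset.prod_insert haS, Finset.prod_insert haT]
  set p := fun i => connProb H L (x i ω) (y i ω)
  calc (p a * ∏ i ∈ T, p i) * ∏ i ∈ S, (1 - p i) +
        (∏ i ∈ T, p i) * ((1 - p a) * ∏ i ∈ S, (1 - p i))
      = (∏ i ∈ T, p i) * (∏ i ∈ S, (1 - p i)) * (p a + (1 - p a)) := by ring
    _ = (∏ i ∈ T, p i) * ∏ i ∈ S, (1 - p i) := by rw [hcompl, mul_one]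

theorem measure_edgePattern (h : IsSoftRGG P L H Φ G) (hH : IsConnectionFunction H)
    (hxy : IsPairSelection Φ A x y) {S T : Finset ι} (hST : Disjoint S T) :
    MeasurableSet (edgePattern G A x y T S) ∧ P (edgePattern G A x y T S) =
      ∫⁻ ω in A, (∏ i ∈ T, connProb H L (x i ω) (y i ω)) *
        ∏ i ∈ S, (1 - connProb H L (x i ω) (y i ω)) ∂P := by
  classical
  have := h.nodes.isProbabilityMeasure
  induction S using Finset.induction_on generalizing T with
  | empty => simpa only [Finset.prod_empty, mul_one] using h.measure_edgePattern_empty hxy T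
  | insert a S haS ih =>
    obtain ⟨haT, hST⟩ := Finset.disjoint_insert_left.1 hST
    obtain ⟨hmeas, hprob⟩ := ih hST
    obtain ⟨hmeas_insert, hprob_insert⟩ := ih (Finset.disjoint_insert_right.2 ⟨haS, hST⟩)
    rw [edgePattern_insert_right]
    refine ⟨hmeas.diff hmeas_insert, ?_⟩
    rw [← ENNReal.add_right_inj (measure_ne_top P (edgePattern G A x y (insert a T) S)),
      measure_add_sdiff hmeas_insert.nullMeasurableSet,
      Set.union_eq_self_of_subset_left (edgePattern_insert_left_subset G A x y T S a), hprob,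
      hprob_insert, h.lintegral_edgePattern_step hH hxy haS haT]

theorem measure_noStarEdges [Fintype ι] (h : IsSoftRGG P L H Φ G) (hH : IsConnectionFunction H)
    {X : ι → Ω → ℝ} {S : ι → Ω → Finset ℝ} (hXS : IsStarSelection Φ A X S) :
    MeasurableSet (noStarEdges G A X S) ∧ P (noStarEdges G A X S) =
      ∫⁻ ω in A, ∏ j, ∏ y ∈ S j ω, (1 - connProb H L (X j ω) y) ∂P := by
  set F : (ι → ℕ) → Set Ω := fun k => A ∩ {ω | ∀ j, (S j ω).card = k j} with hF
  have hF_meas : ∀ k, MeasurableSet (F k) := fun k =>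
    h.configSigma_le _ (hXS.isPairSelection k).measurableSet
  have hF_disjoint : Pairwise (Function.onFun Disjoint F) := fun k l hkl =>
    Set.disjoint_left.2 fun ω hk hl => hkl (funext fun j => (hk.2 j).symm.trans (hl.2 j))
  have hF_iUnion : A = ⋃ k, F k := by
    ext ω
    simpa [hF] using fun _ => ⟨fun j => (S j ω).card, fun _ => rfl⟩
  have hpattern := fun k => h.measure_edgePattern hH (hXS.isPairSelection k)
    (Finset.disjoint_empty_right Finset.univ)
  rw [noStarEdges_eq_iUnion, measure_iUnion (fun k l hkl => (hF_disjoint hkl).mono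
    (fun _ hω => hω.1) (fun _ hω => hω.1)) fun k => (hpattern k).1]
  refine ⟨MeasurableSet.iUnion fun k => (hpattern k).1, ?_⟩
  conv_rhs => rw [hF_iUnion, lintegral_iUnion hF_meas hF_disjoint]
  refine tsum_congr fun k => (hpattern k).2.trans ?_
  refine setLIntegral_congr_fun (hF_meas k) fun ω hω => ?_
  rw [Finset.prod_empty, one_mul, prod_prod_eq_prod_sigma hω.2]

end IsSoftRGG

section IsolatedNodes

/-- The node `x` of the graph `g` on the nodes `s` has no edge to another node. -/
def IsIsolatedNode (s : Finset ℝ) (g : SimpleGraph ℝ) (x : ℝ) : Prop :=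
  ∀ y ∈ s.erase x, ¬ g.Adj x y

lemma isIsolatedNode_and_iff {s : Finset ℝ} {g : SimpleGraph ℝ} {x x' : ℝ} (hx' : x' ∈ s.erase x) :
    IsIsolatedNode s g x ∧ IsIsolatedNode s g x' ↔
      (∀ y ∈ s.erase x, ¬ g.Adj x y) ∧ ∀ y ∈ (s.erase x).erase x', ¬ g.Adj x' y := by
  refine and_congr_right fun hx => ⟨fun h y hy => ?_, fun h y hy => ?_⟩
  · rw [Finset.erase_right_comm] at hy
    exact h y (Finset.mem_of_mem_erase hy)
  · obtain rfl | hyx := eq_or_ne y x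
    · exact fun hadj => hx x' hx' hadj.symm
    · exact h y (by rw [Finset.erase_right_comm]; exact Finset.mem_erase.2 ⟨hyx, hy⟩)

open Classical in
/-- The number of isolated nodes as a natural number, for the counting identities. -/
def isolatedCount (s : Finset ℝ) (g : SimpleGraph ℝ) : ℕ := (s.filter (IsIsolatedNode s g)).card

lemma numIsolated_eq_isolatedCount {Ω : Type*} (Φ : Ω → Finset ℝ) (G : Ω → SimpleGraph ℝ)
    (ω : Ω) : numIsolated Φ G ω = isolatedCount (Φ ω) (G ω) := by
  rw [numIsolated, isolatedCount, ← Set.ncard_coe_finset]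
  congr 2
  ext x
  simp only [IsIsolatedNode, Finset.coe_filter, Finset.mem_erase, Set.mem_ofPred_eq, and_imp,
    forall_comm (α := _ ≠ _)]

open Classical in
lemma isolatedCount_eq_sum (s : Finset ℝ) (g : SimpleGraph ℝ) :
    (isolatedCount s g : ℝ≥0∞) = ∑ x ∈ s, if IsIsolatedNode s g x then 1 else 0 := by
  rw [isolatedCount, Finset.natCast_card_filter]

open Classical in
lemma isolatedCount_sq_eq_sum (s : Finset ℝ) (g : SimpleGraph ℝ) :
    (isolatedCount s g : ℝ≥0∞) ^ 2 = isolatedCount s g + ∑ x ∈ s, ∑ x' ∈ s.erase x,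
      if IsIsolatedNode s g x ∧ IsIsolatedNode s g x' then 1 else 0 := by
  rw [sq, isolatedCount_eq_sum, Finset.sum_mul, ← Finset.sum_add_distrib]
  refine Finset.sum_congr rfl fun x hx => ?_
  rw [← Finset.add_sum_erase _ _ hx]
  by_cases h : IsIsolatedNode s g x <;> simp [h]

/-- The conditional probability that the node `x` is isolated, given the configuration `s`. -/
def isolationProb (H : ℝ → ℝ) (L : ℝ) (s : Finset ℝ) (x : ℝ) : ℝ≥0∞ :=
  ∏ y ∈ s.erase x, (1 - connProb H L x y)

/-- The conditional probability that the distinct nodes `x` and `x'` are both isolated, given the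
configuration `s`. -/
def jointIsolationProb (H : ℝ → ℝ) (L : ℝ) (s : Finset ℝ) (x x' : ℝ) : ℝ≥0∞ :=
  (1 - connProb H L x x') *
    ∏ y ∈ (s.erase x).erase x', (1 - connProb H L x y) * (1 - connProb H L x' y)

lemma jointIsolationProb_eq {H : ℝ → ℝ} {L : ℝ} {s : Finset ℝ} {x x' : ℝ} (hx' : x' ∈ s.erase x) :
    jointIsolationProb H L s x x' = (∏ y ∈ s.erase x, (1 - connProb H L x y)) *
      ∏ y ∈ (s.erase x).erase x', (1 - connProb H L x' y) := by
  rw [jointIsolationProb, Finset.prod_mul_distrib, ← mul_assoc,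
    Finset.mul_prod_erase _ (fun y => 1 - connProb H L x y) hx']

lemma isStarSelection_pair {Ω : Type*} {Φ : Ω → Finset ℝ} {A : Set Ω} {X X' : Ω → ℝ}
    (hA : MeasurableSet[configSigma Φ] A)
    (hX : Measurable[configSigma Φ] X) (hX' : Measurable[configSigma Φ] X')
    (hXΦ : ∀ ω ∈ A, X ω ∈ Φ ω) (hX'Φ : ∀ ω ∈ A, X' ω ∈ (Φ ω).erase (X ω)) :
    IsStarSelection Φ A ![X, X']
      ![fun ω => (Φ ω).erase (X ω), fun ω => ((Φ ω).erase (X ω)).erase (X' ω)] where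
  measurableSet := hA
  measurable_center := Fin.forall_fin_two.2 ⟨hX, hX'⟩
  measurable_leaves := Fin.forall_fin_two.2
    ⟨measurable_config_erase (measurable_config_configSigma Φ) hX,
      measurable_config_erase (measurable_config_erase (measurable_config_configSigma Φ) hX) hX'⟩
  center_mem ω hω := Fin.forall_fin_two.2 ⟨hXΦ ω hω, Finset.mem_of_mem_erase (hX'Φ ω hω)⟩
  leaves_subset ω _ := Fin.forall_fin_two.2 ⟨Finset.erase_subset _ _,
    (Finset.erase_subset _ _).trans (Finset.erase_subset _ _)⟩
  center_notMem ω _ := Fin.forall_fin_two.2 ⟨Finset.notMem_erase _ _, Finset.notMem_erase _ _⟩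
  edge_ne ω hω := by
    have hne : X' ω ≠ X ω := Finset.ne_of_mem_erase (hX'Φ ω hω)
    have hedge : ∀ y ∈ ((Φ ω).erase (X ω)).erase (X' ω), ∀ z, s(X' ω, y) ≠ s(X ω, z) :=
      fun y hy z hyz => by
        rcases Sym2.eq_iff.1 hyz with ⟨hX, -⟩ | ⟨-, hy'⟩
        · exact hne hX
        · exact Finset.ne_of_mem_erase (Finset.mem_of_mem_erase hy) hy'
    simp only [Fin.forall_fin_two]
    exact ⟨⟨fun h => absurd rfl h, fun _ z _ y hy hzy => hedge y hy z hzy.symm⟩,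
      fun _ y hy z _ => hedge y hy z, fun h => absurd rfl h⟩

end IsolatedNodes

section EventIndicator

variable {α : Type*} [MeasurableSpace α] {μ : Measure α} {A : Set α} {q : α → Prop}
  [DecidablePred q]

lemma aemeasurable_ite_restrict (hA : MeasurableSet A) (hq : MeasurableSet {a | a ∈ A ∧ q a}) :
    AEMeasurable (fun a => if q a then (1 : ℝ≥0∞) else 0) (μ.restrict A) := by
  classical
  have hind : A.indicator (fun a => if q a then (1 : ℝ≥0∞) else 0) =
      {a | a ∈ A ∧ q a}.indicator 1 := by
    ext a
    simp only [Set.indicator_apply, Set.mem_ofPred_eq, Pi.one_apply, ite_and]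
  exact (aemeasurable_indicator_iff hA).1 (hind ▸ (measurable_one.indicator hq).aemeasurable)

lemma setLIntegral_ite_one (hA : MeasurableSet A) (hq : MeasurableSet {a | a ∈ A ∧ q a}) :
    ∫⁻ a in A, (if q a then 1 else 0) ∂μ = μ {a | a ∈ A ∧ q a} := by
  classical
  rw [← lintegral_indicator_one hq, ← lintegral_indicator hA]
  simp only [Set.indicator_apply, Set.mem_ofPred_eq, Pi.one_apply, ite_and]

end EventIndicator

section IsolationProb

variable {α : Type*} [MeasurableSpace α] {S : α → Finset ℝ} {X X' : α → ℝ} {H : ℝ → ℝ}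

lemma measurable_isolationProb (hH : IsConnectionFunction H) (L : ℝ) (hS : Measurable S)
    (hX : Measurable X) : Measurable fun a => isolationProb H L (S a) (X a) :=
  measurable_prod_config (by fun_prop) (f := fun a y => 1 - connProb H L (X a) y)
    ((hH.measurable_connProb_comp L (by fun_prop) measurable_snd).const_sub 1)

lemma measurable_jointIsolationProb (hH : IsConnectionFunction H) (L : ℝ) (hS : Measurable S)
    (hX : Measurable X) (hX' : Measurable X') :
    Measurable fun a => jointIsolationProb H L (S a) (X a) (X' a) :=
  ((hH.measurable_connProb_comp L hX hX').const_sub 1).mul <|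
    measurable_prod_config (by fun_prop)
      (f := fun a y => (1 - connProb H L (X a) y) * (1 - connProb H L (X' a) y)) <|
    ((hH.measurable_connProb_comp L (by fun_prop) measurable_snd).const_sub 1).mul
      ((hH.measurable_connProb_comp L (by fun_prop) measurable_snd).const_sub 1)

end IsolationProb

namespace IsSoftRGG

variable {Ω : Type*} [MeasurableSpace Ω] {P : Measure Ω} {L : ℝ} {H : ℝ → ℝ}
  {Φ : Ω → Finset ℝ} {G : Ω → SimpleGraph ℝ} {A : Set Ω} {X X' : Ω → ℝ}

lemma measure_isolated (h : IsSoftRGG P L H Φ G) (hH : IsConnectionFunction H)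
    (hA : MeasurableSet[configSigma Φ] A) (hX : Measurable[configSigma Φ] X)
    (hXΦ : ∀ ω ∈ A, X ω ∈ Φ ω) :
    MeasurableSet {ω | ω ∈ A ∧ IsIsolatedNode (Φ ω) (G ω) (X ω)} ∧
    P {ω | ω ∈ A ∧ IsIsolatedNode (Φ ω) (G ω) (X ω)} =
      ∫⁻ ω in A, isolationProb H L (Φ ω) (X ω) ∂P := by
  have hstar : IsStarSelection Φ A (fun _ : Unit => X) fun _ ω => (Φ ω).erase (X ω) := by
    refine ⟨hA, fun _ => hX, fun _ => measurable_config_erase (measurable_config_configSigma Φ) hX,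
      fun ω hω _ => hXΦ ω hω, fun ω _ _ => Finset.erase_subset _ _,
      fun ω _ _ => Finset.notMem_erase _ _, fun ω _ j j' hj => absurd rfl hj⟩
  simpa only [noStarEdges, isolationProb, IsIsolatedNode, forall_const, Finset.univ_unique,
    Finset.prod_singleton] using h.measure_noStarEdges hH hstar

lemma measure_isolated_pair (h : IsSoftRGG P L H Φ G) (hH : IsConnectionFunction H)
    (hA : MeasurableSet[configSigma Φ] A) (hX : Measurable[configSigma Φ] X)
    (hX' : Measurable[configSigma Φ] X') (hXΦ : ∀ ω ∈ A, X ω ∈ Φ ω)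
    (hX'Φ : ∀ ω ∈ A, X' ω ∈ (Φ ω).erase (X ω)) :
    MeasurableSet {ω | ω ∈ A ∧ IsIsolatedNode (Φ ω) (G ω) (X ω) ∧
      IsIsolatedNode (Φ ω) (G ω) (X' ω)} ∧
    P {ω | ω ∈ A ∧ IsIsolatedNode (Φ ω) (G ω) (X ω) ∧ IsIsolatedNode (Φ ω) (G ω) (X' ω)} =
      ∫⁻ ω in A, jointIsolationProb H L (Φ ω) (X ω) (X' ω) ∂P := by
  have hevent : {ω | ω ∈ A ∧ IsIsolatedNode (Φ ω) (G ω) (X ω) ∧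
      IsIsolatedNode (Φ ω) (G ω) (X' ω)} = noStarEdges G A ![X, X']
        ![fun ω => (Φ ω).erase (X ω), fun ω => ((Φ ω).erase (X ω)).erase (X' ω)] := by
    ext ω
    simp only [noStarEdges, Fin.forall_fin_two, Set.mem_ofPred_eq]
    refine and_congr_right fun hω => isIsolatedNode_and_iff (hX'Φ ω hω)
  obtain ⟨hmeas, hprob⟩ := h.measure_noStarEdges hH (isStarSelection_pair hA hX hX' hXΦ hX'Φ)
  rw [hevent]
  refine ⟨hmeas, hprob.trans (setLIntegral_congr_fun (h.configSigma_le _ hA) fun ω hω => ?_)⟩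
  rw [Fin.prod_univ_two, jointIsolationProb_eq (hX'Φ ω hω)]
  rfl

open Classical in
lemma isolated_orderedPoint (h : IsSoftRGG P L H Φ G) (hH : IsConnectionFunction H) (i : ℕ) :
    AEMeasurable (fun ω => if IsIsolatedNode (Φ ω) (G ω) (orderedPoint (Φ ω) i)
        then (1 : ℝ≥0∞) else 0) (P.restrict {ω | i < (Φ ω).card}) ∧
    ∫⁻ ω in {ω | i < (Φ ω).card},
        (if IsIsolatedNode (Φ ω) (G ω) (orderedPoint (Φ ω) i) then 1 else 0) ∂P =
      ∫⁻ ω in {ω | i < (Φ ω).card}, isolationProb H L (Φ ω) (orderedPoint (Φ ω) i) ∂P := by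
  have hΦ := measurable_config_configSigma Φ
  have hA : MeasurableSet[configSigma Φ] {ω | i < (Φ ω).card} := hΦ (measurableSet_lt_card i)
  obtain ⟨hmeas, hprob⟩ := h.measure_isolated hH hA ((measurable_orderedPoint i).comp hΦ)
    fun ω hω => orderedPoint_mem hω
  have hA' := h.configSigma_le _ hA
  exact ⟨aemeasurable_ite_restrict hA' hmeas, (setLIntegral_ite_one hA' hmeas).trans hprob⟩

lemma aemeasurable_isolatedCount (h : IsSoftRGG P L H Φ G) (hH : IsConnectionFunction H) :
    AEMeasurable (fun ω => (isolatedCount (Φ ω) (G ω) : ℝ≥0∞)) P := by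
  simp only [isolatedCount_eq_sum]
  exact aemeasurable_sum_config h.nodes.measurable_config fun i =>
    (h.isolated_orderedPoint hH i).1

lemma lintegral_isolatedCount (h : IsSoftRGG P L H Φ G) (hH : IsConnectionFunction H) :
    ∫⁻ ω, (isolatedCount (Φ ω) (G ω) : ℝ≥0∞) ∂P =
      ∫⁻ ω, ∑ x ∈ Φ ω, isolationProb H L (Φ ω) x ∂P := by
  have hΦ := h.nodes.measurable_config
  simp only [isolatedCount_eq_sum]
  rw [lintegral_sum_config hΦ fun i => (h.isolated_orderedPoint hH i).1,
    lintegral_sum_config hΦ fun i => (measurable_isolationProb hH L hΦ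
      ((measurable_orderedPoint i).comp hΦ)).aemeasurable]
  exact tsum_congr fun i => (h.isolated_orderedPoint hH i).2

open Classical in
lemma isolated_pair_orderedPoint (h : IsSoftRGG P L H Φ G) (hH : IsConnectionFunction H)
    (i j : ℕ) :
    AEMeasurable (fun ω => if IsIsolatedNode (Φ ω) (G ω) (orderedPoint (Φ ω) i) ∧
        IsIsolatedNode (Φ ω) (G ω) (orderedPartner (Φ ω) i j) then (1 : ℝ≥0∞) else 0)
      (P.restrict (Φ ⁻¹' pairEvent i j)) ∧
    ∫⁻ ω in Φ ⁻¹' pairEvent i j, (if IsIsolatedNode (Φ ω) (G ω) (orderedPoint (Φ ω) i) ∧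
        IsIsolatedNode (Φ ω) (G ω) (orderedPartner (Φ ω) i j) then 1 else 0) ∂P =
      ∫⁻ ω in Φ ⁻¹' pairEvent i j,
        jointIsolationProb H L (Φ ω) (orderedPoint (Φ ω) i) (orderedPartner (Φ ω) i j) ∂P := by
  have hΦ := measurable_config_configSigma Φ
  have hA : MeasurableSet[configSigma Φ] (Φ ⁻¹' pairEvent i j) := hΦ (measurableSet_pairEvent i j)
  obtain ⟨hmeas, hprob⟩ := h.measure_isolated_pair hH hA ((measurable_orderedPoint i).comp hΦ)
    ((measurable_orderedPartner i j).comp hΦ) (fun ω hω => orderedPoint_mem hω.1)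
    fun ω hω => orderedPoint_mem hω.2
  have hA' := h.configSigma_le _ hA
  exact ⟨aemeasurable_ite_restrict hA' hmeas, (setLIntegral_ite_one hA' hmeas).trans hprob⟩

lemma lintegral_isolatedCount_sq (h : IsSoftRGG P L H Φ G) (hH : IsConnectionFunction H) :
    ∫⁻ ω, (isolatedCount (Φ ω) (G ω) : ℝ≥0∞) ^ 2 ∂P =
      (∫⁻ ω, (isolatedCount (Φ ω) (G ω) : ℝ≥0∞) ∂P) +
        ∫⁻ ω, ∑ x ∈ Φ ω, ∑ x' ∈ (Φ ω).erase x, jointIsolationProb H L (Φ ω) x x' ∂P := by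
  have hΦ := h.nodes.measurable_config
  simp only [isolatedCount_sq_eq_sum]
  rw [lintegral_add_left' (h.aemeasurable_isolatedCount hH),
    lintegral_sum_sum_erase_config hΦ fun i j => (h.isolated_pair_orderedPoint hH i j).1,
    lintegral_sum_sum_erase_config hΦ fun i j => (measurable_jointIsolationProb hH L hΦ
      ((measurable_orderedPoint i).comp hΦ) ((measurable_orderedPartner i j).comp hΦ)).aemeasurable]
  simp only [(h.isolated_pair_orderedPoint hH _ _).2]

end IsSoftRGG

section TorusDistance

variable {L x y : ℝ}

lemma torusDist_comm (L x y : ℝ) : torusDist L x y = torusDist L y x := by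
  rw [torusDist, torusDist, abs_sub_comm]

lemma torusDist_eq_norm (hx : x ∈ Set.Icc 0 L) (hy : y ∈ Set.Icc 0 L) :
    torusDist L x y = ‖(x : AddCircle L) - (y : AddCircle L)‖ := by
  wlog hyx : y ≤ x generalizing x y
  · rw [torusDist_comm, this hy hx (le_of_not_ge hyx), norm_sub_rev]
  obtain rfl | hL := (hx.1.trans hx.2).eq_or_lt
  · simp [torusDist, le_antisymm hx.2 hx.1, le_antisymm hy.2 hy.1]
  have hxy : 0 ≤ x - y := sub_nonneg.2 hyx
  rw [← AddCircle.coe_sub, torusDist, abs_of_nonneg hxy]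
  obtain hnear | hfar := le_total (x - y) (L / 2)
  · rw [min_eq_left (by linarith), (AddCircle.norm_coe_eq_abs_iff L hL.ne').2, abs_of_nonneg hxy]
    rwa [abs_of_nonneg hxy, abs_of_pos hL]
  · have hcomplement : 0 ≤ L - (x - y) := by linarith [hx.2, hy.1]
    have hreflect : ‖((x - y : ℝ) : AddCircle L)‖ = ‖((L - (x - y) : ℝ) : AddCircle L)‖ := by
      rw [AddCircle.coe_sub (x := L), AddCircle.coe_period, zero_sub, norm_neg]
    rw [min_eq_right (by linarith), hreflect, (AddCircle.norm_coe_eq_abs_iff L hL.ne').2,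
      abs_of_nonneg hcomplement]
    rw [abs_of_nonneg hcomplement, abs_of_pos hL]
    linarith

lemma setLIntegral_comp_abs {a : ℝ} (ha : 0 ≤ a) (f : ℝ → ℝ≥0∞) :
    ∫⁻ t in Set.Ioc (-a) a, f |t| = 2 * ∫⁻ r in Set.Ioc 0 a, f r := by
  have hpos : ∫⁻ t in Set.Ioc 0 a, f |t| = ∫⁻ r in Set.Ioc 0 a, f r :=
    setLIntegral_congr_fun measurableSet_Ioc fun t ht => by rw [abs_of_pos ht.1]
  have hneg : ∫⁻ t in Set.Ioc (-a) 0, f |t| = ∫⁻ r in Set.Ioc 0 a, f r := by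
    rw [← hpos, setLIntegral_congr Ico_ae_eq_Ioc.symm,
      ← (Measure.measurePreserving_neg volume).setLIntegral_comp_preimage_emb
        (MeasurableEquiv.neg ℝ).measurableEmbedding]
    simp
  rw [← Set.Ioc_union_Ioc_eq_Ioc (neg_nonpos.2 ha) ha,
    lintegral_union measurableSet_Ioc (Set.Ioc_disjoint_Ioc_of_le le_rfl), hpos, hneg, two_mul]

lemma lintegral_torusDist (hx : x ∈ Set.Icc 0 L) (f : ℝ → ℝ≥0∞) :
    ∫⁻ y in Set.Icc 0 L, f (torusDist L x y) = 2 * ∫⁻ r in Set.Ioc 0 (L / 2), f r := by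
  obtain rfl | hL := (hx.1.trans hx.2).eq_or_lt
  · simp
  have : Fact (0 < L) := ⟨hL⟩
  calc ∫⁻ y in Set.Icc 0 L, f (torusDist L x y)
      = ∫⁻ y in Set.Ioc 0 (0 + L), f ‖(x : AddCircle L) - (y : AddCircle L)‖ := by
        rw [zero_add, setLIntegral_congr Ioc_ae_eq_Icc]
        exact setLIntegral_congr_fun measurableSet_Icc fun y hy => by rw [torusDist_eq_norm hx hy]
    _ = ∫⁻ t : AddCircle L, f ‖t‖ := by
        rw [AddCircle.lintegral_preimage L 0 fun b => f ‖(x : AddCircle L) - b‖,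
          lintegral_sub_left_eq_self fun b : AddCircle L => f ‖b‖]
    _ = ∫⁻ t in Set.Ioc (-(L / 2)) (L / 2), f |t| := by
        rw [← AddCircle.lintegral_preimage L (-(L / 2)), (by ring : -(L / 2) + L = L / 2)]
        refine setLIntegral_congr_fun measurableSet_Ioc fun t ht => ?_
        rw [(AddCircle.norm_coe_eq_abs_iff L hL.ne').2]
        rw [abs_of_pos hL]
        exact abs_le.2 ⟨ht.1.le, ht.2⟩
    _ = 2 * ∫⁻ r in Set.Ioc 0 (L / 2), f r := setLIntegral_comp_abs (by positivity) f

end TorusDistance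

section MeanDegree

/-- The expected number of neighbours of a node. The factor `2` is there because a circle of
circumference `L` has two points at each distance below `L / 2` from a given one. -/
def meanDegree (H : ℝ → ℝ) (L : ℝ) : ℝ := 2 * ∫ r in (0 : ℝ)..(L / 2), H r

/-- The expected number of common neighbours of two nodes at `x` and `x'`. -/
def commonDegree (H : ℝ → ℝ) (L x x' : ℝ) : ℝ≥0∞ :=
  ∫⁻ y in Set.Icc 0 L, connProb H L x y * connProb H L x' y

lemma connProb_comm (H : ℝ → ℝ) (L x y : ℝ) : connProb H L x y = connProb H L y x := by
  rw [connProb, connProb, torusDist_comm]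

namespace IsConnectionFunction

variable {H : ℝ → ℝ} {L x x' : ℝ}

lemma measurable_connProb_left (hH : IsConnectionFunction H) (L x : ℝ) :
    Measurable (connProb H L x) :=
  hH.measurable_connProb_comp L measurable_const measurable_id

lemma intervalIntegrable (hH : IsConnectionFunction H) {a : ℝ} (ha : 0 ≤ a) :
    IntervalIntegrable H volume 0 a := by
  rw [intervalIntegrable_iff, Set.uIoc_of_le ha]
  refine Measure.integrableOn_of_bounded (M := 1) (by simp) hH.measurable.aestronglyMeasurable ?_
  refine ae_restrict_of_forall_mem measurableSet_Ioc fun r hr => ?_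
  rw [Real.norm_of_nonneg (hH.nonneg r hr.1.le)]
  exact hH.le_one r hr.1.le

lemma meanDegree_nonneg (hH : IsConnectionFunction H) (hL : 0 ≤ L) : 0 ≤ meanDegree H L :=
  mul_nonneg two_pos.le <|
    intervalIntegral.integral_nonneg (by positivity) fun r hr => hH.nonneg r hr.1

lemma lintegral_connProb (hH : IsConnectionFunction H) (hx : x ∈ Set.Icc 0 L) :
    ∫⁻ y in Set.Icc 0 L, connProb H L x y = ENNReal.ofReal (meanDegree H L) := by
  have hL : 0 ≤ L / 2 := div_nonneg (hx.1.trans hx.2) two_pos.le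
  calc ∫⁻ y in Set.Icc 0 L, connProb H L x y
      = 2 * ∫⁻ r in Set.Ioc 0 (L / 2), ENNReal.ofReal (H r) :=
        lintegral_torusDist hx fun r => ENNReal.ofReal (H r)
    _ = 2 * ENNReal.ofReal (∫ r in (0 : ℝ)..(L / 2), H r) := by
        rw [intervalIntegral.integral_of_le hL, ofReal_integral_eq_lintegral_ofReal
          ((intervalIntegrable_iff_integrableOn_Ioc_of_le hL).1 (hH.intervalIntegrable hL))
          (ae_restrict_of_forall_mem measurableSet_Ioc fun r hr => hH.nonneg r hr.1.le)]
    _ = ENNReal.ofReal (meanDegree H L) := by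
        rw [meanDegree, ENNReal.ofReal_mul two_pos.le, ENNReal.ofReal_ofNat]

lemma measurable_commonDegree (hH : IsConnectionFunction H) (L : ℝ) :
    Measurable (Function.uncurry (commonDegree H L)) := by
  have hmul : Measurable fun p : (ℝ × ℝ) × ℝ =>
      connProb H L p.1.1 p.2 * connProb H L p.1.2 p.2 :=
    (hH.measurable_connProb_comp L (by fun_prop) measurable_snd).mul
      (hH.measurable_connProb_comp L (by fun_prop) measurable_snd)
  exact hmul.lintegral_prod_right'

lemma commonDegree_le (hH : IsConnectionFunction H) (hx : x ∈ Set.Icc 0 L)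
    (hx' : x' ∈ Set.Icc 0 L) : commonDegree H L x x' ≤ ENNReal.ofReal (meanDegree H L) := by
  rw [← hH.lintegral_connProb hx]
  exact setLIntegral_mono' measurableSet_Icc fun y hy =>
    mul_le_of_le_one_right' (hH.connProb_le_one hx' hy)

lemma lintegral_commonDegree (hH : IsConnectionFunction H) (hx : x ∈ Set.Icc 0 L) :
    ∫⁻ x' in Set.Icc 0 L, commonDegree H L x x' = ENNReal.ofReal (meanDegree H L ^ 2) := by
  have hL : 0 ≤ L := hx.1.trans hx.2
  calc ∫⁻ x' in Set.Icc 0 L, commonDegree H L x x'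
      = ∫⁻ y in Set.Icc 0 L, ∫⁻ x' in Set.Icc 0 L, connProb H L x y * connProb H L x' y :=
        lintegral_lintegral_swap <| Measurable.aemeasurable <|
          (hH.measurable_connProb_comp L measurable_const measurable_snd).mul
            (hH.measurable_connProb L)
    _ = ∫⁻ y in Set.Icc 0 L, connProb H L x y * ENNReal.ofReal (meanDegree H L) := by
        refine setLIntegral_congr_fun measurableSet_Icc fun y hy => ?_
        simp only [connProb_comm H L _ y]
        rw [lintegral_const_mul _ (hH.measurable_connProb_left L y), hH.lintegral_connProb hy]
    _ = ENNReal.ofReal (meanDegree H L ^ 2) := by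
        rw [lintegral_mul_const _ (hH.measurable_connProb_left L x), hH.lintegral_connProb hx,
          ← ENNReal.ofReal_mul (hH.meanDegree_nonneg hL), sq]

end IsConnectionFunction

end MeanDegree

section Moments

lemma one_sub_mul_one_sub_add_mul {a b : ℝ≥0∞} (ha : a ≤ 1) (hb : b ≤ 1) :
    1 - (1 - a) * (1 - b) + a * b = a + b := by
  lift a to NNReal using ha.trans_lt ENNReal.one_lt_top |>.ne
  lift b to NNReal using hb.trans_lt ENNReal.one_lt_top |>.ne
  norm_cast at ha hb ⊢
  have hprod : (1 - a) * (1 - b) ≤ 1 := mul_le_one' tsub_le_self tsub_le_self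
  apply NNReal.eq
  push_cast [NNReal.coe_sub hprod, NNReal.coe_sub ha, NNReal.coe_sub hb]
  ring

lemma exp_le_one_add_exp_mul {t c : ℝ} (ht : 0 ≤ t) (htc : t ≤ c) :
    Real.exp t ≤ 1 + Real.exp c * t := by
  have hmul : Real.exp t * (1 - t) ≤ 1 := by
    calc Real.exp t * (1 - t) ≤ Real.exp t * Real.exp (-t) := by
          gcongr
          exact Real.one_sub_le_exp_neg t
      _ = 1 := by rw [← Real.exp_add, add_neg_cancel, Real.exp_zero]
  have hmono : Real.exp t * t ≤ Real.exp c * t := by gcongr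
  linarith

/-- The expected number of isolated nodes: each of the `L` nodes expected on the torus is isolated
with the probability that a Poisson number of neighbours of mean `meanDegree H L` vanishes. -/
def meanIsolated (H : ℝ → ℝ) (L : ℝ) : ℝ := L * Real.exp (-meanDegree H L)

namespace IsConnectionFunction

variable {H : ℝ → ℝ} {L x x' : ℝ}

lemma lintegral_one_sub_mul_add_commonDegree (hH : IsConnectionFunction H)
    (hx : x ∈ Set.Icc 0 L) (hx' : x' ∈ Set.Icc 0 L) :
    (∫⁻ y in Set.Icc 0 L, (1 - (1 - connProb H L x y) * (1 - connProb H L x' y))) +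
      commonDegree H L x x' = 2 * ENNReal.ofReal (meanDegree H L) := by
  have hp := hH.measurable_connProb_left L
  have hmul : Measurable fun y => connProb H L x y * connProb H L x' y := (hp x).mul (hp x')
  rw [commonDegree, ← lintegral_add_right _ hmul,
    setLIntegral_congr_fun measurableSet_Icc fun y hy => one_sub_mul_one_sub_add_mul
      (hH.connProb_le_one hx hy) (hH.connProb_le_one hx' hy),
    lintegral_add_left (hp x), hH.lintegral_connProb hx, hH.lintegral_connProb hx', two_mul]

lemma toReal_lintegral_one_sub_mul (hH : IsConnectionFunction H)
    (hx : x ∈ Set.Icc 0 L) (hx' : x' ∈ Set.Icc 0 L) :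
    (∫⁻ y in Set.Icc 0 L, (1 - (1 - connProb H L x y) * (1 - connProb H L x' y))).toReal =
      2 * meanDegree H L - (commonDegree H L x x').toReal := by
  have hsum := hH.lintegral_one_sub_mul_add_commonDegree hx hx'
  have hfin : _ + commonDegree H L x x' ≠ ∞ := hsum ▸ ENNReal.mul_ne_top (by simp) (by simp)
  have hsum_toReal := congrArg ENNReal.toReal hsum
  rw [ENNReal.toReal_add (ENNReal.add_ne_top.1 hfin).1 (ENNReal.add_ne_top.1 hfin).2,
    ENNReal.toReal_mul, ENNReal.toReal_ofNat,
    ENNReal.toReal_ofReal (hH.meanDegree_nonneg (hx.1.trans hx.2))] at hsum_toReal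
  exact eq_sub_of_add_eq hsum_toReal

end IsConnectionFunction

namespace IsUnitPoissonProcess

variable {Ω : Type*} [MeasurableSpace Ω] {P : Measure Ω} {L : ℝ} {H : ℝ → ℝ}
  {Φ : Ω → Finset ℝ} {x x' : ℝ}

lemma lintegral_prod_one_sub_connProb (h : IsUnitPoissonProcess P L Φ)
    (hH : IsConnectionFunction H) (hx : x ∈ Set.Icc 0 L) :
    ∫⁻ ω, ∏ y ∈ Φ ω, (1 - connProb H L x y) ∂P =
      ENNReal.ofReal (Real.exp (-meanDegree H L)) := by
  rw [h.lintegral_prod_one_sub (hH.measurable_connProb_left L x)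
      fun y hy => hH.connProb_le_one hx hy, hH.lintegral_connProb hx,
    ENNReal.toReal_ofReal (hH.meanDegree_nonneg (hx.1.trans hx.2))]

lemma lintegral_prod_one_sub_connProb_mul (h : IsUnitPoissonProcess P L Φ)
    (hH : IsConnectionFunction H) (hx : x ∈ Set.Icc 0 L) (hx' : x' ∈ Set.Icc 0 L) :
    ∫⁻ ω, ∏ y ∈ Φ ω, (1 - connProb H L x y) * (1 - connProb H L x' y) ∂P =
      ENNReal.ofReal (Real.exp ((commonDegree H L x x').toReal - 2 * meanDegree H L)) := by
  have hu : Measurable fun y => 1 - (1 - connProb H L x y) * (1 - connProb H L x' y) :=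
    (((hH.measurable_connProb_left L x).const_sub 1).mul
      ((hH.measurable_connProb_left L x').const_sub 1)).const_sub 1
  have hcompl (y : ℝ) : (1 - connProb H L x y) * (1 - connProb H L x' y) =
      1 - (1 - (1 - connProb H L x y) * (1 - connProb H L x' y)) :=
    (ENNReal.sub_sub_cancel ENNReal.one_ne_top (mul_le_one' tsub_le_self tsub_le_self)).symm
  rw [lintegral_congr fun ω => Finset.prod_congr rfl fun y _ => hcompl y,
    h.lintegral_prod_one_sub hu fun y _ => tsub_le_self, hH.toReal_lintegral_one_sub_mul hx hx',
    neg_sub]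

lemma lintegral_prod_one_sub_connProb_mul_le (h : IsUnitPoissonProcess P L Φ)
    (hH : IsConnectionFunction H) (hx : x ∈ Set.Icc 0 L) (hx' : x' ∈ Set.Icc 0 L) :
    ∫⁻ ω, ∏ y ∈ Φ ω, (1 - connProb H L x y) * (1 - connProb H L x' y) ∂P ≤
      ENNReal.ofReal (Real.exp (-meanDegree H L) ^ 2) *
        (1 + ENNReal.ofReal (Real.exp (meanDegree H L)) * commonDegree H L x x') := by
  have hc := hH.commonDegree_le hx hx'
  have hexp := exp_le_one_add_exp_mul ENNReal.toReal_nonneg <|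
    ENNReal.toReal_le_of_le_ofReal (hH.meanDegree_nonneg (hx.1.trans hx.2)) hc
  rw [h.lintegral_prod_one_sub_connProb_mul hH hx hx',
    ← ENNReal.ofReal_toReal (ne_top_of_le_ne_top ENNReal.ofReal_ne_top hc),
    ← ENNReal.ofReal_mul (by positivity), ← ENNReal.ofReal_one,
    ← ENNReal.ofReal_add zero_le_one (by positivity), ← ENNReal.ofReal_mul (by positivity),
    ← Real.exp_nat_mul, sub_eq_neg_add, Real.exp_add,
    (by push_cast; ring : (2 : ℕ) * -meanDegree H L = -(2 * meanDegree H L))]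
  rw [ENNReal.toReal_ofReal ENNReal.toReal_nonneg]
  gcongr

theorem lintegral_sum_isolationProb (h : IsUnitPoissonProcess P L Φ)
    (hH : IsConnectionFunction H) :
    ∫⁻ ω, ∑ x ∈ Φ ω, isolationProb H L (Φ ω) x ∂P = ENNReal.ofReal (meanIsolated H L) := by
  calc ∫⁻ ω, ∑ x ∈ Φ ω, isolationProb H L (Φ ω) x ∂P
      = ∫⁻ x in Set.Icc 0 L, ∫⁻ ω, ∏ y ∈ Φ ω, (1 - connProb H L x y) ∂P :=
        h.mecke (F := fun x s => ∏ y ∈ s, (1 - connProb H L x y)) <|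
          measurable_prod_config measurable_snd
            (f := fun p : ℝ × Finset ℝ => fun y => 1 - connProb H L p.1 y)
            ((hH.measurable_connProb_comp L (by fun_prop) measurable_snd).const_sub 1)
    _ = ∫⁻ _ in Set.Icc 0 L, ENNReal.ofReal (Real.exp (-meanDegree H L)) :=
        setLIntegral_congr_fun measurableSet_Icc fun x hx =>
          h.lintegral_prod_one_sub_connProb hH hx
    _ = ENNReal.ofReal (meanIsolated H L) := by
        rw [setLIntegral_const, Real.volume_Icc, sub_zero, ← ENNReal.ofReal_mul (by positivity),
          meanIsolated, mul_comm]

lemma lintegral_sum_sum_jointIsolationProb_le_lintegral (h : IsUnitPoissonProcess P L Φ)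
    (hH : IsConnectionFunction H) :
    ∫⁻ ω, ∑ x ∈ Φ ω, ∑ x' ∈ (Φ ω).erase x, jointIsolationProb H L (Φ ω) x x' ∂P ≤
      ∫⁻ x in Set.Icc 0 L, ∫⁻ x' in Set.Icc 0 L, ENNReal.ofReal (Real.exp (-meanDegree H L) ^ 2) *
        (1 + ENNReal.ofReal (Real.exp (meanDegree H L)) * commonDegree H L x x') := by
  have hF : Measurable fun p : ℝ × ℝ × Finset ℝ => (1 - connProb H L p.1 p.2.1) *
      ∏ y ∈ p.2.2, (1 - connProb H L p.1 y) * (1 - connProb H L p.2.1 y) :=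
    ((hH.measurable_connProb_comp L (by fun_prop) (by fun_prop)).const_sub 1).mul <|
      measurable_prod_config (by fun_prop)
        (f := fun p : ℝ × ℝ × Finset ℝ => fun y =>
          (1 - connProb H L p.1 y) * (1 - connProb H L p.2.1 y)) <|
      ((hH.measurable_connProb_comp L (by fun_prop) measurable_snd).const_sub 1).mul
        ((hH.measurable_connProb_comp L (by fun_prop) measurable_snd).const_sub 1)
  refine (h.mecke_pairs (F := fun x x' s => (1 - connProb H L x x') *
    ∏ y ∈ s, (1 - connProb H L x y) * (1 - connProb H L x' y)) hF).trans_le ?_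
  refine setLIntegral_mono' measurableSet_Icc fun x hx =>
    setLIntegral_mono' measurableSet_Icc fun x' hx' => ?_
  exact (lintegral_mono fun ω => mul_le_of_le_one_left' tsub_le_self).trans
    (h.lintegral_prod_one_sub_connProb_mul_le hH hx hx')

theorem lintegral_sum_sum_jointIsolationProb_le (h : IsUnitPoissonProcess P L Φ)
    (hH : IsConnectionFunction H) (hL : 0 < L) :
    ∫⁻ ω, ∑ x ∈ Φ ω, ∑ x' ∈ (Φ ω).erase x, jointIsolationProb H L (Φ ω) x x' ∂P ≤
      ENNReal.ofReal (meanIsolated H L ^ 2 *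
        (1 + Real.exp (meanDegree H L) * meanDegree H L ^ 2 / L)) := by
  set D := meanDegree H L with hD
  have hinner : ∀ x ∈ Set.Icc 0 L, ∫⁻ x' in Set.Icc 0 L, ENNReal.ofReal (Real.exp (-D) ^ 2) *
      (1 + ENNReal.ofReal (Real.exp D) * commonDegree H L x x') =
      ENNReal.ofReal (Real.exp (-D) ^ 2 * (L + Real.exp D * D ^ 2)) := fun x hx => by
    have hc : Measurable (commonDegree H L x) := (hH.measurable_commonDegree L).of_uncurry_left
    rw [lintegral_const_mul _ (by fun_prop), lintegral_add_left measurable_const,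
      lintegral_const_mul _ hc, hH.lintegral_commonDegree hx, setLIntegral_one, Real.volume_Icc,
      sub_zero, ← ENNReal.ofReal_mul (by positivity), ← ENNReal.ofReal_add hL.le (by positivity),
      ← ENNReal.ofReal_mul (by positivity)]
  refine (h.lintegral_sum_sum_jointIsolationProb_le_lintegral hH).trans_eq ?_
  rw [setLIntegral_congr_fun measurableSet_Icc hinner, setLIntegral_const, Real.volume_Icc,
    sub_zero, ← ENNReal.ofReal_mul (by positivity), meanIsolated, ← hD]
  congr 1
  field_simp

end IsUnitPoissonProcess

end Moments

section Concentration

section Chebyshev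

variable {Ω : Type*} [MeasurableSpace Ω] {P : Measure Ω} {X : Ω → ℝ}

lemma sqCoeffVar_le [IsProbabilityMeasure P] (hX : MemLp X 2 P) (hmean : 0 < ∫ ω, X ω ∂P) {c : ℝ}
    (hsq : ∫ ω, X ω ^ 2 ∂P ≤ ∫ ω, X ω ∂P + (∫ ω, X ω ∂P) ^ 2 * (1 + c)) :
    sqCoeffVar P X ≤ 1 / (∫ ω, X ω ∂P) + c := by
  have hvar : variance X P = ∫ ω, X ω ^ 2 ∂P - (∫ ω, X ω ∂P) ^ 2 := variance_eq_sub hX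
  rw [sqCoeffVar, div_le_iff₀ (by positivity), hvar]
  set m := ∫ ω, X ω ∂P
  calc ∫ ω, X ω ^ 2 ∂P - m ^ 2 ≤ m + m ^ 2 * c := by linarith
    _ = (1 / m + c) * m ^ 2 := by field_simp

lemma measureReal_abs_sub_mean_gt_le [IsFiniteMeasure P] (hX : MemLp X 2 P)
    (hmean : 0 < ∫ ω, X ω ∂P) {ε : ℝ} (hε : 0 < ε) :
    P.real {ω | |X ω - ∫ ω', X ω' ∂P| > ε * ∫ ω', X ω' ∂P} ≤ sqCoeffVar P X / ε ^ 2 := by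
  have hvar : 0 ≤ variance X P := variance_nonneg X P
  calc P.real {ω | |X ω - ∫ ω', X ω' ∂P| > ε * ∫ ω', X ω' ∂P}
      ≤ P.real {ω | ε * ∫ ω', X ω' ∂P ≤ |X ω - ∫ ω', X ω' ∂P|} :=
        measureReal_mono <| Set.ofPred_subset_ofPred.2 fun ω => le_of_lt
    _ ≤ variance X P / (ε * ∫ ω, X ω ∂P) ^ 2 :=
        ENNReal.toReal_le_of_le_ofReal (by positivity)
          (meas_ge_le_variance_div_sq hX (mul_pos hε hmean))
    _ = sqCoeffVar P X / ε ^ 2 := by rw [sqCoeffVar, mul_pow, div_div, mul_comm]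

end Chebyshev

variable {ι : Type*} {l : Filter ι} {Ω : ι → Type*} [∀ i, MeasurableSpace (Ω i)]
  {P : ∀ i, Measure (Ω i)} [∀ i, IsFiniteMeasure (P i)] {X : ∀ i, Ω i → ℝ}

lemma tendsto_measureReal_abs_sub_mean_gt (hX : ∀ᶠ i in l, MemLp (X i) 2 (P i))
    (hmean : ∀ᶠ i in l, 0 < ∫ ω, X i ω ∂(P i))
    (hcv : Tendsto (fun i => sqCoeffVar (P i) (X i)) l (𝓝 0)) {ε : ℝ} (hε : 0 < ε) :
    Tendsto (fun i => (P i).real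
      {ω | |X i ω - ∫ ω', X i ω' ∂(P i)| > ε * ∫ ω', X i ω' ∂(P i)}) l (𝓝 0) := by
  refine squeeze_zero' (Eventually.of_forall fun i => measureReal_nonneg) ?_
    (by simpa only [zero_div] using hcv.div_const (ε ^ 2))
  filter_upwards [hX, hmean] with i hXi hmi using measureReal_abs_sub_mean_gt_le hXi hmi hε

lemma tendsto_measureReal_abs_div_sub_gt {m b : ι → ℝ} {a : ℝ} (hb : ∀ᶠ i in l, 0 < b i)
    (hm : Tendsto (fun i => m i / b i) l (𝓝 a))
    (hconc : ∀ ε : ℝ, 0 < ε →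
      Tendsto (fun i => (P i).real {ω | |X i ω - m i| > ε * m i}) l (𝓝 0)) {ε : ℝ} (hε : 0 < ε) :
    Tendsto (fun i => (P i).real {ω | |X i ω / b i - a| > ε}) l (𝓝 0) := by
  have hδ : 0 < ε / 2 / (|a| + 1) := by positivity
  refine squeeze_zero' (Eventually.of_forall fun i => measureReal_nonneg) ?_ (hconc _ hδ)
  filter_upwards [hb, hm.eventually_lt_const ((le_abs_self a).trans_lt (lt_add_one |a|)),
    Metric.tendsto_nhds.1 hm (ε / 2) (half_pos hε)] with i hbi hratio hclose
  refine measureReal_mono fun ω (hω : ε < |X i ω / b i - a|) => ?_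
  have hdev : ε / 2 < |X i ω - m i| / b i := by
    have habs : |X i ω - m i| / b i = |X i ω / b i - m i / b i| := by
      rw [← sub_div, abs_div, abs_of_pos hbi]
    have htriangle := abs_sub_le (X i ω / b i) (m i / b i) a
    rw [Real.dist_eq] at hclose
    linarith
  calc ε / 2 / (|a| + 1) * m i
      = ε / 2 / (|a| + 1) * (m i / b i) * b i := by field_simp
    _ ≤ ε / 2 / (|a| + 1) * (|a| + 1) * b i := by gcongr
    _ = ε / 2 * b i := by field_simp
    _ < |X i ω - m i| := (lt_div_iff₀ hbi).1 hdev

end Concentration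

section IsolatedNodeMoments

variable {H : ℝ → ℝ}

lemma meanIsolated_pos (H : ℝ → ℝ) {L : ℝ} (hL : 0 < L) : 0 < meanIsolated H L :=
  mul_pos hL (Real.exp_pos _)

namespace IsConnectionFunction

lemma meanDegree_le (hH : IsConnectionFunction H) (hint : IntegrableOn H (Set.Ioi 0)) {L : ℝ}
    (hL : 0 ≤ L) : meanDegree H L ≤ 2 * l1Norm H := by
  rw [meanDegree, intervalIntegral.integral_of_le (by positivity), l1Norm]
  gcongr
  · exact ae_restrict_of_forall_mem measurableSet_Ioi fun r hr => hH.nonneg r (le_of_lt hr)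
  · exact Set.Ioc_subset_Ioi_self

end IsConnectionFunction

lemma tendsto_meanDegree (hint : IntegrableOn H (Set.Ioi 0)) :
    Tendsto (meanDegree H) atTop (𝓝 (2 * l1Norm H)) :=
  (intervalIntegral_tendsto_integral_Ioi 0 hint (tendsto_id.atTop_div_const two_pos)).const_mul 2

lemma tendsto_meanIsolated_div (hint : IntegrableOn H (Set.Ioi 0)) :
    Tendsto (fun L => meanIsolated H L / L) atTop (𝓝 (Real.exp (-2 * l1Norm H))) := by
  rw [neg_mul]
  refine ((Real.continuous_exp.tendsto _).comp (tendsto_meanDegree hint).neg).congr' ?_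
  filter_upwards [eventually_gt_atTop 0] with L hL
  rw [meanIsolated, mul_div_cancel_left₀ _ hL.ne', Function.comp_apply]

lemma tendsto_meanIsolated_atTop (hint : IntegrableOn H (Set.Ioi 0)) :
    Tendsto (meanIsolated H) atTop atTop := by
  refine ((tendsto_meanIsolated_div hint).pos_mul_atTop (Real.exp_pos _) tendsto_id).congr' ?_
  filter_upwards [eventually_gt_atTop 0] with L hL using div_mul_cancel₀ _ hL.ne'

lemma ofReal_numIsolated_pow {Ω : Type*} (Φ : Ω → Finset ℝ) (G : Ω → SimpleGraph ℝ)
    (ω : Ω) (k : ℕ) :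
    ENNReal.ofReal (numIsolated Φ G ω ^ k) = (isolatedCount (Φ ω) (G ω) : ℝ≥0∞) ^ k := by
  rw [numIsolated_eq_isolatedCount, ENNReal.ofReal_pow (Nat.cast_nonneg _), ENNReal.ofReal_natCast]

namespace IsSoftRGG

section FixedSize

variable {Ω : Type*} [MeasurableSpace Ω] {P : Measure Ω} {L : ℝ} {Φ : Ω → Finset ℝ}
  {G : Ω → SimpleGraph ℝ}

lemma lintegral_isolatedCount_sq_le (h : IsSoftRGG P L H Φ G) (hH : IsConnectionFunction H)
    (hL : 0 < L) : ∫⁻ ω, (isolatedCount (Φ ω) (G ω) : ℝ≥0∞) ^ 2 ∂P ≤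
      ENNReal.ofReal (meanIsolated H L + meanIsolated H L ^ 2 *
        (1 + Real.exp (meanDegree H L) * meanDegree H L ^ 2 / L)) := by
  have hmean := meanIsolated_pos H hL
  rw [h.lintegral_isolatedCount_sq hH, h.lintegral_isolatedCount hH,
    h.nodes.lintegral_sum_isolationProb hH, ENNReal.ofReal_add hmean.le (by positivity)]
  gcongr
  exact h.nodes.lintegral_sum_sum_jointIsolationProb_le hH hL

lemma aestronglyMeasurable_numIsolated (h : IsSoftRGG P L H Φ G) (hH : IsConnectionFunction H) :
    AEStronglyMeasurable (numIsolated Φ G) P := by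
  refine ((h.aemeasurable_isolatedCount hH).ennreal_toReal.congr <|
    Eventually.of_forall fun ω => ?_).aestronglyMeasurable
  exact (ENNReal.toReal_natCast _).trans (numIsolated_eq_isolatedCount Φ G ω).symm

lemma integral_numIsolated_pow (h : IsSoftRGG P L H Φ G) (hH : IsConnectionFunction H)
    (k : ℕ) : ∫ ω, numIsolated Φ G ω ^ k ∂P =
      (∫⁻ ω, (isolatedCount (Φ ω) (G ω) : ℝ≥0∞) ^ k ∂P).toReal := by
  have hmeas : AEStronglyMeasurable (fun ω => numIsolated Φ G ω ^ k) P :=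
    (h.aestronglyMeasurable_numIsolated hH).pow k
  have hnonneg (ω : Ω) : 0 ≤ numIsolated Φ G ω ^ k := by
    rw [numIsolated_eq_isolatedCount]
    positivity
  rw [integral_eq_lintegral_of_nonneg_ae (Eventually.of_forall hnonneg) hmeas]
  simp only [ofReal_numIsolated_pow]

theorem integral_numIsolated (h : IsSoftRGG P L H Φ G) (hH : IsConnectionFunction H)
    (hL : 0 < L) : ∫ ω, numIsolated Φ G ω ∂P = meanIsolated H L := by
  have hmean := h.integral_numIsolated_pow hH 1
  simp only [pow_one] at hmean
  rw [hmean, h.lintegral_isolatedCount hH, h.nodes.lintegral_sum_isolationProb hH,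
    ENNReal.toReal_ofReal (meanIsolated_pos H hL).le]

theorem memLp_numIsolated (h : IsSoftRGG P L H Φ G) (hH : IsConnectionFunction H) (hL : 0 < L) :
    MemLp (numIsolated Φ G) 2 P := by
  have hmeas := h.aestronglyMeasurable_numIsolated hH
  refine (memLp_two_iff_integrable_sq hmeas).2 ⟨hmeas.pow 2, ?_⟩
  rw [hasFiniteIntegral_iff_ofReal (Eventually.of_forall fun ω => sq_nonneg _)]
  simp only [ofReal_numIsolated_pow]
  exact (h.lintegral_isolatedCount_sq_le hH hL).trans_lt ENNReal.ofReal_lt_top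

theorem sqCoeffVar_numIsolated_le (h : IsSoftRGG P L H Φ G)
    (hH : IsConnectionFunction H) (hL : 0 < L) :
    sqCoeffVar P (numIsolated Φ G) ≤
      1 / meanIsolated H L + Real.exp (meanDegree H L) * meanDegree H L ^ 2 / L := by
  have := h.nodes.isProbabilityMeasure
  have hmean := h.integral_numIsolated hH hL
  have hpos := meanIsolated_pos H hL
  rw [← hmean]
  refine sqCoeffVar_le (h.memLp_numIsolated hH hL) (by rwa [hmean]) ?_
  rw [hmean, h.integral_numIsolated_pow hH]
  exact ENNReal.toReal_le_of_le_ofReal (by positivity) (h.lintegral_isolatedCount_sq_le hH hL)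

theorem sqCoeffVar_numIsolated_le_l1Norm (h : IsSoftRGG P L H Φ G)
    (hH : IsConnectionFunction H) (hint : IntegrableOn H (Set.Ioi 0)) (hL : 0 < L) :
    sqCoeffVar P (numIsolated Φ G) ≤
      1 / meanIsolated H L + 4 * Real.exp (2 * l1Norm H) * l1Norm H ^ 2 / L := by
  have hD := hH.meanDegree_nonneg hL.le
  have hD_le := hH.meanDegree_le hint hL.le
  calc sqCoeffVar P (numIsolated Φ G)
      ≤ 1 / meanIsolated H L + Real.exp (meanDegree H L) * meanDegree H L ^ 2 / L :=
        h.sqCoeffVar_numIsolated_le hH hL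
    _ ≤ 1 / meanIsolated H L + Real.exp (2 * l1Norm H) * (2 * l1Norm H) ^ 2 / L := by gcongr
    _ = 1 / meanIsolated H L + 4 * Real.exp (2 * l1Norm H) * l1Norm H ^ 2 / L := by ring

end FixedSize

theorem tendsto_sqCoeffVar_numIsolated {Ω : ℝ → Type*} [∀ L, MeasurableSpace (Ω L)]
    {P : ∀ L, Measure (Ω L)} {Φ : ∀ L, Ω L → Finset ℝ}
    {G : ∀ L, Ω L → SimpleGraph ℝ} (h : ∀ L, 0 < L → IsSoftRGG (P L) L H (Φ L) (G L))
    (hH : IsConnectionFunction H) (hint : IntegrableOn H (Set.Ioi 0)) :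
    Tendsto (fun L => sqCoeffVar (P L) (numIsolated (Φ L) (G L))) atTop (𝓝 0) := by
  have hlim : Tendsto (fun L => 1 / meanIsolated H L +
      4 * Real.exp (2 * l1Norm H) * l1Norm H ^ 2 / L) atTop (𝓝 (0 + 0)) :=
    ((tendsto_meanIsolated_atTop hint).const_div_atTop 1).add (tendsto_id.const_div_atTop _)
  rw [add_zero] at hlim
  refine squeeze_zero' (Eventually.of_forall fun L =>
    div_nonneg (variance_nonneg _ _) (sq_nonneg _)) ?_ hlim
  filter_upwards [eventually_gt_atTop 0] with L hL
    using (h L hL).sqCoeffVar_numIsolated_le_l1Norm hH hint hL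

end IsSoftRGG

end IsolatedNodeMoments

end

theorem mainTheorem2 (H : ℝ → ℝ) (hH_meas : Measurable H)
    (hH_range : ∀ r : ℝ, 0 ≤ r → 0 ≤ H r ∧ H r ≤ 1)
    (hH_int : IntegrableOn H (Set.Ioi (0 : ℝ))) :
    -- for every system size: mean, variance bound with a constant depending only on `H`, Chebyshev
    (∃ C : ℝ, ∀ L : ℝ, 0 < L →
      ∀ (Ω : Type u) [MeasurableSpace Ω] (P : Measure Ω) [IsProbabilityMeasure P]
        (Φ : Ω → Finset ℝ) (G : Ω → SimpleGraph ℝ), IsSoftRGG P L H Φ G →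
        MemLp (numIsolated Φ G) 2 P ∧
        ∫ ω, numIsolated Φ G ω ∂P = L * Real.exp (-2 * ∫ r in (0 : ℝ)..(L / 2), H r) ∧
        sqCoeffVar P (numIsolated Φ G) ≤
          1 / (∫ ω, numIsolated Φ G ω ∂P) + 4 * C * l1Norm H ^ 2 / L ∧
        ∀ ε : ℝ, 0 < ε →
          P.real {ω | |numIsolated Φ G ω - ∫ ω', numIsolated Φ G ω' ∂P| >
              ε * ∫ ω', numIsolated Φ G ω' ∂P} ≤
            sqCoeffVar P (numIsolated Φ G) / ε ^ 2) ∧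
    -- as the system size tends to infinity: linear growth and concentration
    (∀ (Ω : ℝ → Type u) [∀ L, MeasurableSpace (Ω L)] (P : ∀ L, Measure (Ω L))
      [∀ L, IsProbabilityMeasure (P L)]
      (Φ : ∀ L, Ω L → Finset ℝ) (G : ∀ L, Ω L → SimpleGraph ℝ),
      (∀ L : ℝ, 0 < L → IsSoftRGG (P L) L H (Φ L) (G L)) →
      Tendsto (fun L : ℝ => (∫ ω, numIsolated (Φ L) (G L) ω ∂(P L)) / L) atTop
        (𝓝 (Real.exp (-2 * l1Norm H))) ∧
      ∀ ε : ℝ, 0 < ε →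
        Tendsto (fun L : ℝ => (P L).real
          {ω | |numIsolated (Φ L) (G L) ω - ∫ ω', numIsolated (Φ L) (G L) ω' ∂(P L)| >
            ε * ∫ ω', numIsolated (Φ L) (G L) ω' ∂(P L)}) atTop (𝓝 0) ∧
        Tendsto (fun L : ℝ => (P L).real
          {ω | |numIsolated (Φ L) (G L) ω / L - Real.exp (-2 * l1Norm H)| > ε})
          atTop (𝓝 0)) := by
  have hH : IsConnectionFunction H :=
    ⟨hH_meas, fun r hr => (hH_range r hr).1, fun r hr => (hH_range r hr).2⟩
  refine ⟨⟨Real.exp (2 * l1Norm H), fun L hL Ω _ P _ Φ G h => ?_⟩, fun Ω _ P _ Φ G h => ?_⟩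
  · have hmean := h.integral_numIsolated hH hL
    have hmemLp := h.memLp_numIsolated hH hL
    refine ⟨hmemLp, ?_, ?_, fun ε hε => measureReal_abs_sub_mean_gt_le hmemLp ?_ hε⟩
    · rw [hmean, meanIsolated, meanDegree, neg_mul]
    · rw [hmean]
      exact h.sqCoeffVar_numIsolated_le_l1Norm hH hH_int hL
    · rw [hmean]
      exact meanIsolated_pos H hL
  · have hL_pos : ∀ᶠ L : ℝ in atTop, 0 < L := eventually_gt_atTop 0
    have hmean := hL_pos.mono fun L hL => (h L hL).integral_numIsolated hH hL
    have hgrowth := (tendsto_meanIsolated_div hH_int).congr'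
      (hmean.mono fun L hm => congrArg (· / L) hm.symm)
    have hconc := fun ε (hε : (0 : ℝ) < ε) => tendsto_measureReal_abs_sub_mean_gt
      (hL_pos.mono fun L hL => (h L hL).memLp_numIsolated hH hL)
      (hmean.mp <| hL_pos.mono fun L hL hm => hm ▸ meanIsolated_pos H hL)
      (IsSoftRGG.tendsto_sqCoeffVar_numIsolated h hH hH_int) hε
    exact ⟨hgrowth, fun ε hε =>
      ⟨hconc ε hε, tendsto_measureReal_abs_div_sub_gt hL_pos hgrowth hconc hε⟩⟩
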